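/- **Corollary 4.3.** Let $x$ be a finite rooted full binary tree with $n\ge 2$ leaves and let $\rho$ be the right-vine with $n$ leaves (the tree obtained from the trivial tree by $n-1$ times gluing a caret on the last leaf). Let $\mathcal F=\mathrm{FS}\langle a,b\mid x(a)=\rho(b)\rangle$ be the forest-skein category presented by two colours $a,b$ and one skein relation: its objects are the natural numbers, its morphisms $r\leftarrow l$ are the lists of $r$ binary trees with $l$ leaves in total and with interior vertices coloured by $a$ or $b$, taken modulo the smallest equivalence relation that is closed under vertical concatenation $\circ$ (gluing roots on leaves) and horizontal concatenation $\otimes$ (juxtaposition) and identifies $x$ with all vertices coloured $a$ with $\rho$ with all vertices coloured $b$. Let $G$ be its ($F$-type) forest-skein group, that is, the isotropy group at the object $1$ of the enveloping (fraction) groupoid of $\mathcal F$; its elements are the fractions $[t,s]=t\circ s^{-1}$ of trees $t,s$ of $\mathcal F$ with equal numbers of leaves. Assume that $\mathcal F$ is simple: every surjective monoidal functor, preserving numbers of leaves, from $\mathcal F$ onto a left-cancellative forest-skein category (one with any set of colours and any set of skein relations between trees with equal numbers of leaves) is an isomorphism. Let $\mathcal I F$ be the group of the homeomorphisms $h$ of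 $\mathbf R/\mathbf Z$ fixing $0$ such that the set $BP(h)$ of points where $h$ is not differentiable is contained in $\mathbf Z[1/2]/\mathbf Z$ and has finitely many accumulation points, for each accumulation point $p$ there is $q$ such that $(p,q)\cap BP(h)=\emptyset$, $h(\mathbf Z[1/2]/\mathbf Z)\subset \mathbf Z[1/2]/\mathbf Z$, and all slopes of $h$ are (integer) powers of $2$. Then: 1. $\mathcal I F$ is bi-orderable, that is, it has a total order invariant under left and right multiplication, and there is an injective group homomorphism $G\hookrightarrow\mathcal I F$; 2. $G$ is bi-orderable; 3. every subgroup of $G$ that has (as a discrete group) Kazhdan's property (T) is trivial. -/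

import Mathlib

open CategoryTheory Filter Topology

/-! ### Free forests -/

namespace ForestSkein

universe u v

/-- A tree coloured over `S`: a finite rooted full binary tree whose interior vertices carry
colours. The trivial tree is `BinaryTree.nil`; a caret with root colour `c` and with `l`, `r`
glued on its two leaves is `BinaryTree.node c l r`. -/
abbrev FreeTree (S : Type u) : Type u := BinaryTree S

/-- A free forest over `S`: a finite list of coloured trees. -/
abbrev FreeForest (S : Type u) : Type u := List (FreeTree S)

/-- The number of leaves of a free forest; its number of roots is its length. -/
def leaves {S : Type u} (f : FreeForest S) : ℕ := (f.map BinaryTree.numLeaves).sum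

/-- Glue the `i`-th tree of the list on the `i`-th leaf of a tree. -/
def graft {S : Type u} : FreeTree S → FreeForest S → FreeTree S
  | .nil, g => g.headD .nil
  | .node c l r, g => .node c (graft l (g.take l.numLeaves)) (graft r (g.drop l.numLeaves))

/-- Vertical concatenation `f ∘ g`: glue the `i`-th tree of `g` on the `i`-th leaf of `f`.
It is meaningful when `g` has as many roots as `f` has leaves. -/
def stack {S : Type u} : FreeForest S → FreeForest S → FreeForest S
  | [], _ => []
  | t :: f, g => graft t (g.take t.numLeaves) :: stack f (g.drop t.numLeaves)

section FreeLemmas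

variable {S : Type u}

@[simp] theorem leaves_nil : leaves ([] : FreeForest S) = 0 := rfl

@[simp] theorem leaves_cons (t : FreeTree S) (f : FreeForest S) :
    leaves (t :: f) = t.numLeaves + leaves f := by simp [leaves]

@[simp] theorem leaves_append (f g : FreeForest S) : leaves (f ++ g) = leaves f + leaves g := by
  simp [leaves]

@[simp] theorem leaves_replicate (n : ℕ) :
    leaves (List.replicate n (BinaryTree.nil : FreeTree S)) = n := by simp [leaves]

@[simp] theorem length_stack (f g : FreeForest S) : (stack f g).length = f.length := by
  induction f generalizing g with
  | nil => rfl
  | cons t f ih => simp [stack, ih]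

theorem leaves_take_add_drop (k : ℕ) (g : FreeForest S) :
    leaves (g.take k) + leaves (g.drop k) = leaves g := by
  rw [← leaves_append, List.take_append_drop]

theorem numLeaves_graft (t : FreeTree S) (g : FreeForest S) (h : g.length = t.numLeaves) :
    (graft t g).numLeaves = leaves g := by
  induction t generalizing g with
  | nil =>
    obtain ⟨s, rfl⟩ := List.length_eq_one_iff.1 h
    simp [graft]
  | node c l r ihl ihr =>
    simp only [BinaryTree.numLeaves] at h
    rw [graft, BinaryTree.numLeaves, ihl _ (by simp; omega), ihr _ (by simp; omega),
      leaves_take_add_drop]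

theorem leaves_stack (f g : FreeForest S) (h : g.length = leaves f) :
    leaves (stack f g) = leaves g := by
  induction f generalizing g with
  | nil =>
    have : g = [] := List.length_eq_zero_iff.1 h
    simp [stack, this]
  | cons t f ih =>
    simp only [leaves_cons] at h
    rw [stack, leaves_cons, numLeaves_graft _ _ (by simp; omega), ih _ (by simp; omega),
      leaves_take_add_drop]

theorem graft_replicate (t : FreeTree S) :
    graft t (List.replicate t.numLeaves .nil) = t := by
  induction t with
  | nil => rfl
  | node c l r ihl ihr => simp [graft, ihl, ihr]

theorem stack_replicate (f : FreeForest S) :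
    stack f (List.replicate (leaves f) .nil) = f := by
  induction f with
  | nil => rfl
  | cons t f ih => simp [stack, ih, graft_replicate]

theorem replicate_stack (g : FreeForest S) :
    stack (List.replicate g.length .nil) g = g := by
  induction g with
  | nil => rfl
  | cons t g ih => simp [List.replicate_succ, stack, graft, ih]

theorem stack_append (f₁ f₂ g : FreeForest S) :
    stack (f₁ ++ f₂) g = stack f₁ (g.take (leaves f₁)) ++ stack f₂ (g.drop (leaves f₁)) := by
  induction f₁ generalizing g with
  | nil => simp [stack]
  | cons t f₁ ih =>
    simp [stack, ih, List.take_take, List.drop_take, List.drop_drop]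

theorem stack_take (k : ℕ) (g h : FreeForest S) :
    stack (g.take k) (h.take (leaves (g.take k))) = (stack g h).take k := by
  by_cases hk : k ≤ g.length
  · conv_rhs => rw [← List.take_append_drop k g, stack_append]
    rw [List.take_left' (by simp [hk])]
  · push Not at hk
    have h₁ : (stack g h).length ≤ k := (length_stack g h).trans_le hk.le
    have := stack_append g [] h
    rw [List.take_of_length_le hk.le, List.take_of_length_le h₁]
    simpa [stack] using this.symm

theorem stack_drop (k : ℕ) (g h : FreeForest S) :
    stack (g.drop k) (h.drop (leaves (g.take k))) = (stack g h).drop k := by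
  by_cases hk : k ≤ g.length
  · conv_rhs => rw [← List.take_append_drop k g, stack_append]
    rw [List.drop_left' (by simp [hk])]
  · push Not at hk
    have h₁ : (stack g h).length ≤ k := (length_stack g h).trans_le hk.le
    rw [List.drop_of_length_le hk.le, List.drop_of_length_le h₁]
    rfl

theorem graft_graft (t : FreeTree S) (g h : FreeForest S) (hg : g.length = t.numLeaves)
    (hh : h.length = leaves g) : graft (graft t g) h = graft t (stack g h) := by
  induction t generalizing g h with
  | nil =>
    obtain ⟨s, rfl⟩ := List.length_eq_one_iff.1 hg
    simp only [leaves_cons, leaves_nil, add_zero] at hh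
    simp [graft, stack, ← hh]
  | node c l r ihl ihr =>
    simp only [BinaryTree.numLeaves] at hg
    have hl : (g.take l.numLeaves).length = l.numLeaves := by simp; omega
    have hr : (g.drop l.numLeaves).length = r.numLeaves := by simp; omega
    have hs := leaves_take_add_drop l.numLeaves g
    rw [graft, graft, graft, numLeaves_graft _ _ hl, ihl _ _ hl (by simp; omega),
      ihr _ _ hr (by simp; omega), stack_take, stack_drop]

theorem stack_assoc (f g h : FreeForest S) (hg : g.length = leaves f)
    (hh : h.length = leaves g) : stack (stack f g) h = stack f (stack g h) := by
  induction f generalizing g h with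
  | nil => rfl
  | cons t f ih =>
    simp only [leaves_cons] at hg
    have hl : (g.take t.numLeaves).length = t.numLeaves := by simp; omega
    have hr : (g.drop t.numLeaves).length = leaves f := by simp; omega
    have hs := leaves_take_add_drop t.numLeaves g
    rw [stack, stack, stack, numLeaves_graft _ _ hl, graft_graft _ _ _ hl (by simp; omega),
      ih _ _ hr (by simp; omega), stack_take, stack_drop]

end FreeLemmas

/-! ### Presented forest-skein categories -/

/-- A skein presentation `⟨S | R⟩`: a set of colours and a set of pairs of coloured trees having
the same number of leaves. -/
structure SkeinPresentation where
  Colour : Type u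
  Rel : FreeTree Colour → FreeTree Colour → Prop
  numLeaves_eq : ∀ s t, Rel s t → s.numLeaves = t.numLeaves

/-- The smallest equivalence relation on free forests that contains the skein relations and is
closed under vertical and horizontal concatenation. -/
inductive SkeinEq (P : SkeinPresentation.{u}) : FreeForest P.Colour → FreeForest P.Colour → Prop
  | rel (s t : FreeTree P.Colour) : P.Rel s t → SkeinEq P [s] [t]
  | refl (f : FreeForest P.Colour) : SkeinEq P f f
  | symm (f g : FreeForest P.Colour) : SkeinEq P f g → SkeinEq P g f
  | trans (f g h : FreeForest P.Colour) : SkeinEq P f g → SkeinEq P g h → SkeinEq P f h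
  | stack (f f' g g' : FreeForest P.Colour) : g.length = leaves f → g'.length = leaves f' →
      SkeinEq P f f' → SkeinEq P g g' → SkeinEq P (stack f g) (stack f' g')
  | append (f f' g g' : FreeForest P.Colour) :
      SkeinEq P f f' → SkeinEq P g g' → SkeinEq P (f ++ g) (f' ++ g')

theorem SkeinEq.leaves_length {P : SkeinPresentation.{u}} {f g : FreeForest P.Colour}
    (h : SkeinEq P f g) : leaves f = leaves g ∧ f.length = g.length := by
  induction h with
  | rel s t h => simp [P.numLeaves_eq s t h]
  | refl f => simp
  | symm f g _ ih => exact ⟨ih.1.symm, ih.2.symm⟩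
  | trans f g h _ _ ih₁ ih₂ => exact ⟨ih₁.1.trans ih₂.1, ih₁.2.trans ih₂.2⟩
  | stack f f' g g' h h' _ _ ih₁ ih₂ =>
    rw [leaves_stack _ _ h, leaves_stack _ _ h']
    simp [ih₁.2, ih₂.1]
  | append f f' g g' _ _ ih₁ ih₂ => simp [ih₁, ih₂]

/-- Free forests `f : r ← l` with `l` leaves and `r` roots. -/
@[ext] structure FreeHom (P : SkeinPresentation.{u}) (l r : ℕ) : Type u where
  forest : FreeForest P.Colour
  leaves_eq : leaves forest = l
  length_eq : forest.length = r

instance skeinSetoid (P : SkeinPresentation.{u}) (l r : ℕ) : Setoid (FreeHom P l r) where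
  r f g := SkeinEq P f.forest g.forest
  iseqv := ⟨fun f => .refl f.forest, fun h => .symm _ _ h, fun h h' => .trans _ _ _ h h'⟩

/-- The objects of the forest-skein category presented by `P`: the natural numbers. -/
@[ext] structure FSCat (P : SkeinPresentation.{u}) : Type where
  size : ℕ

/-- The forest-skein category presented by `P`. A morphism from `l` to `r` is a forest with `l`
leaves and `r` roots up to the skein relations, and the composite `f ∘ g`, written `g ≫ f`, is
vertical concatenation. -/
instance FSCat.category (P : SkeinPresentation.{u}) : Category.{u} (FSCat P) where
  Hom X Y := Quotient (skeinSetoid P X.size Y.size)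
  id X := Quotient.mk _ ⟨List.replicate X.size .nil, by simp, by simp⟩
  comp {X Y Z} p q := Quotient.map₂
    (fun (g : FreeHom P X.size Y.size) (f : FreeHom P Y.size Z.size) =>
      (⟨stack f.forest g.forest,
        (leaves_stack _ _ (g.length_eq.trans f.leaves_eq.symm)).trans g.leaves_eq,
        (length_stack _ _).trans f.length_eq⟩ : FreeHom P X.size Z.size))
    (fun g g' hg f f' hf => SkeinEq.stack _ _ _ _ (g.length_eq.trans f.leaves_eq.symm)
      (g'.length_eq.trans f'.leaves_eq.symm) hf hg) p q
  id_comp {X Y} p := by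
    induction p using Quotient.inductionOn with
    | h f =>
      refine congrArg (Quotient.mk _) (FreeHom.ext ?_)
      change stack f.forest (List.replicate X.size .nil) = f.forest
      have h := stack_replicate f.forest
      rwa [f.leaves_eq] at h
  comp_id {X Y} p := by
    induction p using Quotient.inductionOn with
    | h f =>
      refine congrArg (Quotient.mk _) (FreeHom.ext ?_)
      change stack (List.replicate Y.size .nil) f.forest = f.forest
      have h := replicate_stack f.forest
      rwa [f.length_eq] at h
  assoc {W X Y Z} p q r := by
    induction p using Quotient.inductionOn with
    | h h =>
      induction q using Quotient.inductionOn with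
      | h g =>
        induction r using Quotient.inductionOn with
        | h f =>
          refine congrArg (Quotient.mk _) (FreeHom.ext ?_)
          exact (stack_assoc f.forest g.forest h.forest (g.length_eq.trans f.leaves_eq.symm)
            (h.length_eq.trans g.leaves_eq.symm)).symm

/-- Horizontal concatenation `f ⊗ g` of forests. -/
def tensor {P : SkeinPresentation.{u}} {l r l' r' : ℕ}
    (p : (⟨l⟩ : FSCat P) ⟶ ⟨r⟩) (q : (⟨l'⟩ : FSCat P) ⟶ ⟨r'⟩) :
    (⟨l + l'⟩ : FSCat P) ⟶ ⟨r + r'⟩ :=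
  Quotient.map₂
    (fun (f : FreeHom P l r) (g : FreeHom P l' r') =>
      (⟨f.forest ++ g.forest, by simp [f.leaves_eq, g.leaves_eq],
        by simp [f.length_eq, g.length_eq]⟩ : FreeHom P (l + l') (r + r')))
    (fun _ _ hf _ _ hg => SkeinEq.append _ _ _ _ hf hg) p q

/-- A morphism of forest-skein categories: a monoidal functor that preserves the number of
leaves. Such a functor is the identity on objects, so it is given by its action on forests. -/
structure FSMorphism (P P' : SkeinPresentation.{u}) where
  map : ∀ {l r : ℕ}, ((⟨l⟩ : FSCat P) ⟶ ⟨r⟩) → ((⟨l⟩ : FSCat P') ⟶ ⟨r⟩)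
  map_id : ∀ n : ℕ, map (𝟙 (⟨n⟩ : FSCat P)) = 𝟙 (⟨n⟩ : FSCat P')
  map_comp : ∀ {l m r : ℕ} (g : (⟨l⟩ : FSCat P) ⟶ ⟨m⟩) (f : (⟨m⟩ : FSCat P) ⟶ ⟨r⟩),
    map (g ≫ f) = map g ≫ map f
  map_tensor : ∀ {l r l' r' : ℕ} (f : (⟨l⟩ : FSCat P) ⟶ ⟨r⟩) (g : (⟨l'⟩ : FSCat P) ⟶ ⟨r'⟩),
    map (tensor f g) = tensor (map f) (map g)

/-- `f ∘ p = f ∘ q` implies `p = q`. -/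
def LeftCancellative (P : SkeinPresentation.{u}) : Prop :=
  ∀ (X Y Z : FSCat P) (f : Y ⟶ Z) (p q : X ⟶ Y), p ≫ f = q ≫ f → p = q

/-- A forest-skein category is simple if no proper quotient of it is left-cancellative, where a
quotient is a surjective morphism to a forest-skein category, and it is proper if it is not an
isomorphism. Every forest-skein category is isomorphic to a presented one, so it suffices to let
the target range over these. -/
def IsSimpleFS (P : SkeinPresentation.{u}) : Prop :=
  ∀ (P' : SkeinPresentation.{u}) (Φ : FSMorphism P P'),
    (∀ l r : ℕ, Function.Surjective (Φ.map (l := l) (r := r))) →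
    LeftCancellative P' →
    ∀ l r : ℕ, Function.Injective (Φ.map (l := l) (r := r))

/-- The forest-skein group of `F`-type: the isotropy group at the object `1` of the enveloping
groupoid, in which all forests are formally inverted. When the category is Ore this groupoid is
the groupoid of fractions, and the group consists of the fractions `[t, s] = t ∘ s⁻¹` of trees
with equal numbers of leaves, with `[t, s] * [s, r] = [t, r]`. -/
abbrev FSGroup (P : SkeinPresentation.{u}) : Type u :=
  Aut ((⊤ : MorphismProperty (FSCat P)).Q.obj ⟨1⟩)

/-! ### The skein presentation `⟨a, b | x(a) = ρ(b)⟩` -/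

/-- The two colours. -/
inductive TwoColours : Type
  | a
  | b

/-- The monochromatic tree `x` with all interior vertices coloured by `c`. -/
def colourBy {S : Type u} (c : S) (x : BinaryTree Unit) : FreeTree S := x.map fun _ => c

/-- The right-vine with `k` carets (hence `k + 1` leaves). -/
def rightVine : ℕ → BinaryTree Unit
  | 0 => .nil
  | k + 1 => .node () .nil (rightVine k)

theorem numLeaves_colourBy {S : Type u} (c : S) (x : BinaryTree Unit) :
    (colourBy c x).numLeaves = x.numLeaves := by
  induction x with
  | nil => rfl
  | node _ l r ihl ihr => simp only [colourBy] at *; simp [BinaryTree.map, ihl, ihr]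

theorem numLeaves_rightVine (k : ℕ) : (rightVine k).numLeaves = k + 1 := by
  induction k with
  | zero => rfl
  | succ k ih => simp [rightVine, ih]; omega

/-- The presentation with colours `a`, `b` and the single skein relation `x(a) = ρ(b)`, where `ρ`
is the right-vine with as many leaves as `x`. -/
def vinePresentation (x : BinaryTree Unit) : SkeinPresentation.{0} where
  Colour := TwoColours
  Rel s t := s = colourBy .a x ∧ t = colourBy .b (rightVine x.numNodes)
  numLeaves_eq := by
    rintro s t ⟨rfl, rfl⟩
    rw [numLeaves_colourBy, numLeaves_colourBy, numLeaves_rightVine,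
      BinaryTree.numLeaves_eq_numNodes_succ]

/-! ### Infinite piecewise linear transformations -/

/-- The set `ℤ[1/2]` of dyadic rationals. -/
def dyadics : Set ℝ := {x | ∃ (m : ℤ) (k : ℕ), x = m / 2 ^ k}

/-- The breakpoints of a real function: the points at which it is not differentiable. -/
def breakpoints (f : ℝ → ℝ) : Set ℝ := {x | ¬ DifferentiableAt ℝ f x}

/-- `IsInfinitePL f` says that `f` is the lift, fixing `0`, of an element of `𝓘F`. -/
structure IsInfinitePL (f : ℝ ≃o ℝ) : Prop where
  map_zero : f 0 = 0
  map_add_one : ∀ x, f (x + 1) = f x + 1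
  finite_acc : {p ∈ Set.Ico (0 : ℝ) 1 | AccPt p (𝓟 (breakpoints f))}.Finite
  acc_left : ∀ p, AccPt p (𝓟 (breakpoints f)) → ∃ q > p, Set.Ioo p q ∩ breakpoints f = ∅
  breakpoints_dyadic : breakpoints f ⊆ dyadics
  map_dyadic : ∀ x ∈ dyadics, f x ∈ dyadics
  slope : ∀ x ∉ breakpoints f, ∃ k : ℤ, deriv f x = 2 ^ k


/-- `f` is affine with slope a power of two immediately to the right of `x`. -/
def RightAffine (f : ℝ → ℝ) (x : ℝ) : Prop :=
  ∃ k : ℤ, ∃ q > x, ∀ y ∈ Set.Ico x q, f y = f x + 2 ^ k * (y - x)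

theorem IsInfinitePL.rightAffine {f : ℝ ≃o ℝ} (hf : IsInfinitePL f) (x : ℝ) :
    RightAffine f x := by
  obtain ⟨q, hq, hB⟩ : ∃ q > x, ∀ y ∈ Set.Ioo x q, y ∉ breakpoints f := by
    by_cases h : AccPt x (𝓟 (breakpoints f))
    · obtain ⟨q, hq, hB⟩ := hf.acc_left x h
      exact ⟨q, hq, fun y hy hy' => Set.notMem_empty y (hB ▸ ⟨hy, hy'⟩)⟩
    · rw [accPt_iff_nhds] at h
      push Not at h
      obtain ⟨U, hU, h⟩ := h
      obtain ⟨ε, hε, hb⟩ := Metric.mem_nhds_iff.1 hU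
      refine ⟨x + ε, by linarith, fun y hy hy' => ?_⟩
      have hy1 := hy.1
      have hy2 := hy.2
      have : y ∈ U := hb (by rw [Metric.mem_ball, Real.dist_eq, abs_lt]; constructor <;> linarith)
      exact hy.1.ne' (h y ⟨this, hy'⟩)
  have hd : ∀ y ∈ Set.Ioo x q, DifferentiableAt ℝ f y := fun y hy => not_not.1 (hB y hy)
  have hoc := Set.OrdConnected.image_deriv (f := f) (Set.ordConnected_Ioo (a := x) (b := q)) hd
  have hlt : ∀ y ∈ Set.Ioo x q, ∀ z ∈ Set.Ioo x q, ¬ deriv f y < deriv f z := by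
    intro y hy z hz h
    obtain ⟨k, hk⟩ := hf.slope y (hB y hy)
    obtain ⟨l, hl⟩ := hf.slope z (hB z hz)
    rw [hk, hl] at h
    have hkl : k < l := (zpow_lt_zpow_iff_right₀ (by norm_num)).1 h
    have hpos : (0 : ℝ) < 2 ^ k := by positivity
    have h1 : (2 : ℝ) ^ (k + 1) = 2 ^ k * 2 := zpow_add_one₀ (by norm_num) k
    have h2 : (2 : ℝ) ^ (k + 1) ≤ 2 ^ l := zpow_le_zpow_right₀ (by norm_num) hkl
    obtain ⟨w, hw, hw'⟩ := hoc.out (Set.mem_image_of_mem _ hy) (Set.mem_image_of_mem _ hz)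
      (show (3 / 2 : ℝ) * 2 ^ k ∈ Set.Icc (deriv f y) (deriv f z) by
        rw [hk, hl]; constructor <;> linarith)
    obtain ⟨m, hm⟩ := hf.slope w (hB w hw)
    rw [hm] at hw'
    have h3 : k < m := (zpow_lt_zpow_iff_right₀ (one_lt_two (α := ℝ))).1 (by linarith)
    have h4 : m < k + 1 := (zpow_lt_zpow_iff_right₀ (one_lt_two (α := ℝ))).1 (by linarith)
    omega
  have hmid : (x + q) / 2 ∈ Set.Ioo x q := by constructor <;> linarith
  obtain ⟨k, hk⟩ := hf.slope _ (hB _ hmid)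
  refine ⟨k, q, hq, fun y hy => ?_⟩
  rcases hy.1.eq_or_lt with rfl | hxy
  · simp
  · obtain ⟨c, hc, hc'⟩ := exists_deriv_eq_slope f hxy f.continuous.continuousOn
      (fun z hz => (hd z ⟨hz.1, hz.2.trans hy.2⟩).differentiableWithinAt)
    have hcm : c ∈ Set.Ioo x q := ⟨hc.1, hc.2.trans hy.2⟩
    have : deriv f c = 2 ^ k := by
      rw [← hk]
      exact le_antisymm (not_lt.1 (hlt _ hmid _ hcm)) (not_lt.1 (hlt _ hcm _ hmid))
    rw [this, eq_div_iff (by linarith)] at hc'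
    linarith

theorem RightAffine.acc_left {f : ℝ → ℝ} {x : ℝ} (h : RightAffine f x) :
    ∃ q > x, Set.Ioo x q ∩ breakpoints f = ∅ := by
  obtain ⟨k, q, hq, h⟩ := h
  refine ⟨q, hq, Set.eq_empty_of_forall_notMem fun y ⟨hy, hy'⟩ => hy' ?_⟩
  have : (fun z => f x + 2 ^ k * (z - x)) =ᶠ[𝓝 y] f := by
    filter_upwards [Ioo_mem_nhds hy.1 hy.2] with z hz using (h z ⟨hz.1.le, hz.2⟩).symm
  exact DifferentiableAt.congr_of_eventuallyEq (by fun_prop) this.symm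

theorem RightAffine.slope {f : ℝ → ℝ} {x : ℝ} (h : RightAffine f x)
    (hx : x ∉ breakpoints f) : ∃ k : ℤ, deriv f x = 2 ^ k := by
  obtain ⟨k, q, hq, h⟩ := h
  refine ⟨k, ?_⟩
  have h1 : HasDerivWithinAt f (deriv f x) (Set.Ici x) x :=
    (not_not.1 hx : DifferentiableAt ℝ f x).hasDerivAt.hasDerivWithinAt
  have h2 : HasDerivAt (fun z => f x + 2 ^ k * (z - x)) ((2 : ℝ) ^ k) x := by
    simpa using (((hasDerivAt_id x).sub_const x).const_mul ((2 : ℝ) ^ k)).const_add (f x)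
  have h3 : HasDerivWithinAt f ((2 : ℝ) ^ k) (Set.Ici x) x := by
    refine h2.hasDerivWithinAt.congr_of_eventuallyEq ?_ (by simp)
    filter_upwards [Ico_mem_nhdsGE hq] with z hz using h z hz
  exact (uniqueDiffWithinAt_Ici x).eq_deriv _ h1 h3

theorem RightAffine.comp {f g : ℝ ≃o ℝ} {x : ℝ} (hf : RightAffine f (g x))
    (hg : RightAffine g x) : RightAffine (f * g : ℝ ≃o ℝ) x := by
  obtain ⟨k, q, hq, hf⟩ := hf
  obtain ⟨l, r, hr, hg⟩ := hg
  refine ⟨k + l, min r (g.symm q), lt_min hr ((OrderIso.lt_symm_apply g).2 hq), fun y hy => ?_⟩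
  have h1 := hg y ⟨hy.1, hy.2.trans_le (min_le_left _ _)⟩
  have h2 := hf (g y) ⟨g.monotone hy.1,
    (OrderIso.lt_symm_apply g).1 (hy.2.trans_le (min_le_right _ _))⟩
  change f (g y) = f (g x) + _
  rw [h2, h1, zpow_add₀ (by norm_num)]
  ring

theorem RightAffine.symm {f : ℝ ≃o ℝ} {y : ℝ} (hf : RightAffine f (f.symm y)) :
    RightAffine f.symm y := by
  obtain ⟨k, q, hq, hf⟩ := hf
  refine ⟨-k, f q, (OrderIso.symm_apply_lt f).1 hq, fun w hw => ?_⟩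
  have h := hf (f.symm w) ⟨f.symm.monotone hw.1, (OrderIso.symm_apply_lt f).2 hw.2⟩
  rw [OrderIso.apply_symm_apply, OrderIso.apply_symm_apply] at h
  have hpos : (0 : ℝ) < 2 ^ k := by positivity
  have h' : w - y = 2 ^ k * (f.symm w - f.symm y) := by linarith
  rw [h', zpow_neg, inv_mul_cancel_left₀ hpos.ne']
  ring

theorem zpow_mul_dyadic (k : ℤ) {x : ℝ} (hx : x ∈ dyadics) : 2 ^ k * x ∈ dyadics := by
  obtain ⟨m, n, rfl⟩ := hx
  obtain ⟨j, rfl | rfl⟩ := k.eq_nat_or_neg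
  · exact ⟨2 ^ j * m, n, by push_cast; rw [zpow_natCast]; ring⟩
  · exact ⟨m, n + j, by rw [zpow_neg, zpow_natCast, pow_add]; field_simp⟩

theorem sub_dyadic {x y : ℝ} (hx : x ∈ dyadics) (hy : y ∈ dyadics) : x - y ∈ dyadics := by
  obtain ⟨m, n, rfl⟩ := hx
  obtain ⟨p, q, rfl⟩ := hy
  refine ⟨m * 2 ^ q - p * 2 ^ n, n + q, ?_⟩
  push_cast
  rw [pow_add]
  field_simp

theorem exists_dyadic_between {x y : ℝ} (h : x < y) : ∃ z ∈ dyadics, x < z ∧ z < y := by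
  obtain ⟨n, hn⟩ := exists_pow_lt_of_lt_one (sub_pos.2 h) (by norm_num : (1 / 2 : ℝ) < 1)
  have hp : (0 : ℝ) < 2 ^ n := by positivity
  have h1 := Int.lt_floor_add_one (x * 2 ^ n)
  have h2 := Int.floor_le (x * 2 ^ n)
  rw [one_div, inv_pow, inv_lt_iff_one_lt_mul₀ hp] at hn
  refine ⟨((⌊x * 2 ^ n⌋ + 1 : ℤ) : ℝ) / 2 ^ n, ⟨_, n, rfl⟩, ?_, ?_⟩
  · rw [lt_div_iff₀ hp]; push_cast; linarith
  · rw [div_lt_iff₀ hp]; push_cast; nlinarith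

theorem accPt_of_preimage (g : ℝ ≃o ℝ) {B : Set ℝ} {p : ℝ} (h : AccPt p (𝓟 (g ⁻¹' B))) :
    AccPt (g p) (𝓟 B) := by
  rw [accPt_iff_nhds] at h ⊢
  intro U hU
  obtain ⟨y, hy, hne⟩ := h (g ⁻¹' U) (g.continuous.continuousAt hU)
  exact ⟨g y, hy, fun e => hne (g.injective e)⟩

theorem IsInfinitePL.map_Ico {f : ℝ ≃o ℝ} (hf : IsInfinitePL f) {x : ℝ} :
    f x ∈ Set.Ico (0 : ℝ) 1 ↔ x ∈ Set.Ico (0 : ℝ) 1 := by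
  have h1 : f 1 = 1 := by simpa [hf.map_zero] using hf.map_add_one 0
  simp only [Set.mem_Ico]
  conv_lhs => rw [← h1, ← hf.map_zero, f.le_iff_le, f.lt_iff_lt]

theorem IsInfinitePL.one : IsInfinitePL 1 := by
  have hd : ∀ x, HasDerivAt ((1 : ℝ ≃o ℝ) : ℝ → ℝ) 1 x := fun x => hasDerivAt_id x
  have h : breakpoints (1 : ℝ ≃o ℝ) = ∅ :=
    Set.eq_empty_of_forall_notMem fun x hx => hx (hd x).differentiableAt
  have ha : ∀ p : ℝ, ¬ AccPt p (𝓟 (breakpoints (1 : ℝ ≃o ℝ))) := by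
    intro p hp
    rw [accPt_iff_nhds] at hp
    obtain ⟨y, hy, -⟩ := hp _ univ_mem
    exact Set.notMem_empty y (h ▸ hy.2)
  exact ⟨rfl, fun _ => rfl, Set.Finite.subset Set.finite_empty fun p hp => ha p hp.2,
    fun p hp => (ha p hp).elim, h ▸ Set.empty_subset _, fun _ hx => hx,
    fun x _ => ⟨0, by rw [(hd x).deriv, zpow_zero]⟩⟩

theorem IsInfinitePL.mul {f g : ℝ ≃o ℝ} (hf : IsInfinitePL f) (hg : IsInfinitePL g) :
    IsInfinitePL (f * g) := by
  have hB : breakpoints (f * g : ℝ ≃o ℝ) ⊆ breakpoints g ∪ g ⁻¹' breakpoints f := by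
    intro x hx
    by_contra h
    rw [Set.mem_union, not_or] at h
    exact hx ((not_not.1 h.2 : DifferentiableAt ℝ f (g x)).comp x (not_not.1 h.1))
  have hR : ∀ x, RightAffine (f * g : ℝ ≃o ℝ) x := fun x =>
    (hf.rightAffine (g x)).comp (hg.rightAffine x)
  refine ⟨?_, fun x => ?_, ?_, fun p _ => (hR p).acc_left, fun x hx => ?_,
    fun x hx => hf.map_dyadic _ (hg.map_dyadic x hx), fun x hx => (hR x).slope hx⟩
  · change f (g 0) = 0
    rw [hg.map_zero, hf.map_zero]
  · change f (g (x + 1)) = f (g x) + 1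
    rw [hg.map_add_one, hf.map_add_one]
  · refine (hg.finite_acc.union (hf.finite_acc.preimage g.injective.injOn)).subset ?_
    rintro p ⟨hp, hacc⟩
    have h := hacc.mono (principal_mono.2 hB)
    rw [← sup_principal, accPt_sup] at h
    rcases h with h | h
    · exact Or.inl ⟨hp, h⟩
    · exact Or.inr ⟨hg.map_Ico.2 hp, accPt_of_preimage g h⟩
  · by_contra hn
    obtain ⟨k, q, hq, h⟩ := hg.rightAffine x
    rcases hB hx with h' | h'
    · exact hn (hg.breakpoints_dyadic h')
    · obtain ⟨z, hz, hxz, hzq⟩ := exists_dyadic_between hq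
      have h1 := h z ⟨hxz.le, hzq⟩
      have h2 := zpow_mul_dyadic (-k) (sub_dyadic (hg.map_dyadic z hz) (hf.breakpoints_dyadic h'))
      have h3 := sub_dyadic hz h2
      have hpos : (0 : ℝ) < 2 ^ k := by positivity
      rw [h1, zpow_neg] at h3
      apply hn
      convert h3 using 1
      field_simp
      ring

theorem IsInfinitePL.inv {f : ℝ ≃o ℝ} (hf : IsInfinitePL f) : IsInfinitePL f⁻¹ := by
  change IsInfinitePL f.symm
  have hB : breakpoints f.symm ⊆ f.symm ⁻¹' breakpoints f := by
    intro x hx h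
    obtain ⟨k, hk⟩ := hf.slope (f.symm x) (not_not.2 h)
    refine hx (HasDerivAt.of_local_left_inverse (f' := 2 ^ k) f.symm.continuous.continuousAt
      (hk ▸ h.hasDerivAt) (by positivity) (Eventually.of_forall f.apply_symm_apply)).differentiableAt
  have hR : ∀ x, RightAffine f.symm x := fun x => (hf.rightAffine _).symm
  refine ⟨?_, fun x => ?_, ?_, fun p _ => (hR p).acc_left, fun x hx => ?_, fun y hy => ?_,
    fun x hx => (hR x).slope hx⟩
  · rw [OrderIso.symm_apply_eq, hf.map_zero]
  · rw [OrderIso.symm_apply_eq, hf.map_add_one, f.apply_symm_apply]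
  · refine (hf.finite_acc.preimage f.symm.injective.injOn).subset ?_
    rintro p ⟨hp, hacc⟩
    refine ⟨hf.map_Ico.1 (by rwa [f.apply_symm_apply]), ?_⟩
    exact accPt_of_preimage f.symm (hacc.mono (principal_mono.2 hB))
  · have := hf.map_dyadic _ (hf.breakpoints_dyadic (hB hx))
    rwa [f.apply_symm_apply] at this
  · obtain ⟨k, q, hq, h⟩ := hf.rightAffine (f.symm y)
    obtain ⟨z, hz, hxz, hzq⟩ := exists_dyadic_between hq
    have h1 := h z ⟨hxz.le, hzq⟩
    have h3 := sub_dyadic hz (zpow_mul_dyadic (-k) (sub_dyadic (hf.map_dyadic z hz) hy))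
    have hpos : (0 : ℝ) < 2 ^ k := by positivity
    rw [h1, f.apply_symm_apply, zpow_neg] at h3
    convert h3 using 1
    field_simp
    ring

/-- The group `𝓘F`. An element is a homeomorphism of `ℝ/ℤ` that fixes `0` and has positive
slopes, and it is represented by its unique lift to `ℝ` that fixes `0`. -/
def InfinitePLGroup : Subgroup (ℝ ≃o ℝ) where
  carrier := {f | IsInfinitePL f}
  one_mem' := .one
  mul_mem' := .mul
  inv_mem' := .inv

/-! ### Bi-orderability and property (T) -/

/-- The group `Γ` has a total order invariant under left and right multiplication. -/
def BiOrderable (Γ : Type u) [Group Γ] : Prop :=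
  ∃ _ : LinearOrder Γ, ∀ a b c : Γ, a ≤ b → c * a ≤ c * b ∧ a * c ≤ b * c

/-- Kazhdan's property (T) for a discrete group: there are a finite set `K` and `ε > 0` such that
each unitary representation that has a `(K, ε)`-invariant unit vector has a non-zero invariant
vector. -/
def KazhdanPropertyT (Γ : Type u) [Group Γ] : Prop :=
  ∃ (K : Finset Γ) (ε : ℝ), 0 < ε ∧
    ∀ (H : Type u) [NormedAddCommGroup H] [InnerProductSpace ℂ H] [CompleteSpace H]
      (π : Γ →* (H ≃ₗᵢ[ℂ] H)),
      (∃ v : H, ‖v‖ = 1 ∧ ∀ g ∈ K, ‖π g v - v‖ < ε) → ∃ v : H, v ≠ 0 ∧ ∀ g, π g v = v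

end ForestSkein

namespace ForestSkein

universe u

/-! ### Forests acting on the real line -/

/-! Let forests act on the real line: a tree with `n` leaves carries `[0, n]` onto `[0, 1]` and is a
translation on either side. Gluing then becomes composition (`forestMap_stack`), so an action of the
free forests amounts to one homeomorphism for each colour.

Let `a` act by the dyadic caret, `T` be the translation by `1`, `X` the action of `x(a)` and `s = n
- 1`. If `b` acts by `R T⁻¹`, the right-vine with `s` carets acts by `R ^ s T⁻ˢ`, so the skein
relation asks for an `s`-th root `R` of `Y = X Tˢ`. Now `Y` is the translation by `s` near `-∞`,
fixes `[1, ∞)` and pushes every point below `1` to the right; on `(-∞, 1)` it is therefore conjugate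
to the translation by `s`, and `R` is the same conjugate of `T`. Near each point below `1`, `R`
equals `Yᵐ T Y⁻ᵐ` for some `m`. Hence `R` is piecewise linear, and its pieces can accumulate only at
`1`, from the left, as `𝓘F` permits.

Actions are invertible, so identifying forests with equal actions gives a left-cancellative
quotient, and simplicity makes the action faithful. Every tree can be refined to one of colour `a`
only, which gives common multiples. Hence each element of the group is a fraction `t ∘ s⁻¹`; it acts
by a homeomorphism supported in `[0, 1]`, faithfully, and its periodic extension lies in `𝓘F`.

Elements of `𝓘F` are affine just to the right of every point. Two distinct ones thus have a first
point of separation, at which their right slopes differ, and comparing them there gives a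
bi-invariant order. For property (T), take a Kazhdan pair `(K, ε)` and let `p` be the least point at
which a non-trivial element of `K` starts to move. The pointwise stabilizer of `[0, p]` contains
`K`, so it has finite index; it is closed under roots, so it is everything. The logarithm of the
right slope at `p` is then a non-zero homomorphism to `ℤ`, which property (T) forbids. So `K` has no
non-trivial element, the group is finite, and being torsion-free it is trivial. -/

/-- The translation `x ↦ x + c`. -/
def translate (c : ℝ) : ℝ ≃o ℝ := OrderIso.addRight c

@[simp] theorem translate_apply (c x : ℝ) : translate c x = x + c := rfl

theorem translate_mul (c d : ℝ) : translate c * translate d = translate (c + d) := by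
  ext x
  simp [RelIso.mul_apply]
  ring

@[simp] theorem translate_zero : translate 0 = 1 := by
  ext x
  simp

@[simp] theorem translate_inv (c : ℝ) : (translate c)⁻¹ = translate (-c) := by
  rw [inv_eq_iff_mul_eq_one, translate_mul, add_neg_cancel, translate_zero]

/-- Conjugation by the translation by `c`. -/
def conjTranslate (c : ℝ) : (ℝ ≃o ℝ) →* (ℝ ≃o ℝ) := (MulAut.conj (translate c)).toMonoidHom

theorem conjTranslate_def (c : ℝ) (g : ℝ ≃o ℝ) :
    conjTranslate c g = translate c * g * translate (-c) := by
  simp [conjTranslate]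

@[simp] theorem conjTranslate_apply (c : ℝ) (g : ℝ ≃o ℝ) (x : ℝ) :
    conjTranslate c g x = g (x - c) + c := by
  simp [conjTranslate_def, RelIso.mul_apply, sub_eq_add_neg]

theorem conjTranslate_add (c d : ℝ) (g : ℝ ≃o ℝ) :
    conjTranslate (c + d) g = conjTranslate c (conjTranslate d g) := by
  ext x
  simp only [conjTranslate_apply, sub_sub]
  ring

@[simp] theorem conjTranslate_zero (g : ℝ ≃o ℝ) : conjTranslate 0 g = g := by
  ext x
  simp

/-- `u` maps `[0, l]` onto `[0, r]` and is a translation on either side. -/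
structure TranslatesOutside (u : ℝ ≃o ℝ) (l r : ℕ) : Prop where
  apply_of_nonpos : ∀ x ≤ 0, u x = x
  apply_of_ge : ∀ x : ℝ, l ≤ x → u x = x + (r - l)

namespace TranslatesOutside

theorem one (n : ℕ) : TranslatesOutside 1 n n := ⟨fun _ _ => rfl, fun x _ => by simp⟩

theorem apply_right {u : ℝ ≃o ℝ} {l r : ℕ} (hu : TranslatesOutside u l r) : u l = r := by
  rw [hu.apply_of_ge _ le_rfl]
  ring

theorem mul {u v : ℝ ≃o ℝ} {l m r : ℕ} (hu : TranslatesOutside u m r)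
    (hv : TranslatesOutside v l m) : TranslatesOutside (u * v) l r := by
  refine ⟨fun x hx => ?_, fun x hx => ?_⟩
  · rw [RelIso.mul_apply, hv.apply_of_nonpos x hx, hu.apply_of_nonpos x hx]
  · rw [RelIso.mul_apply, hv.apply_of_ge x hx, hu.apply_of_ge _ (by linarith)]
    ring

theorem inv {u : ℝ ≃o ℝ} {l r : ℕ} (hu : TranslatesOutside u l r) :
    TranslatesOutside u⁻¹ r l := by
  refine ⟨fun x hx => ?_, fun x hx => ?_⟩
  · exact (OrderIso.symm_apply_eq u).2 (hu.apply_of_nonpos x hx).symm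
  · refine (OrderIso.symm_apply_eq u).2 ?_
    rw [hu.apply_of_ge _ (by linarith)]
    ring

/-- The two factors live on opposite sides of `l`: to the right of it `u` is the translation by `r -
l`, to the left of it the shifted `v` is the identity. This is the interchange law of the monoidal
structure. -/
theorem interchange {u v : ℝ ≃o ℝ} {l r : ℕ} (hu : TranslatesOutside u l r)
    (hv : ∀ x ≤ 0, v x = x) : u * conjTranslate l v = conjTranslate r v * u := by
  ext x
  simp only [RelIso.mul_apply, conjTranslate_apply]
  rcases le_total x l with h | h
  · have h' : u x ≤ r := hu.apply_right ▸ u.monotone h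
    rw [hv _ (by linarith), hv _ (by linarith)]
    simp
  · have h' : 0 ≤ v (x - l) := by
      have := v.monotone (sub_nonneg.2 h)
      rwa [hv 0 le_rfl] at this
    rw [hu.apply_of_ge x h, hu.apply_of_ge _ (by linarith)]
    ring_nf

theorem tensor {u v : ℝ ≃o ℝ} {l r l' r' : ℕ} (hu : TranslatesOutside u l r)
    (hv : TranslatesOutside v l' r') :
    TranslatesOutside (u * conjTranslate l v) (l + l') (r + r') := by
  refine ⟨fun x hx => ?_, fun x hx => ?_⟩
  · have hl : (0 : ℝ) ≤ l := Nat.cast_nonneg l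
    rw [RelIso.mul_apply, conjTranslate_apply, hv.apply_of_nonpos _ (by linarith),
      sub_add_cancel, hu.apply_of_nonpos x hx]
  · push_cast at hx ⊢
    have hr : (0 : ℝ) ≤ r' := Nat.cast_nonneg r'
    rw [RelIso.mul_apply, conjTranslate_apply, hv.apply_of_ge _ (by linarith),
      hu.apply_of_ge _ (by linarith)]
    ring

end TranslatesOutside

/-! ### Gluing of forests as composition of transformations -/

section TreeMap

variable {S : Type u} (h : S → (ℝ ≃o ℝ))

/-- The transformation of the line given by a tree: its `i`-th leaf interval is the image of
`[i, i + 1]`. The caret of colour `c` acts by `h c`. -/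
def treeMap : FreeTree S → (ℝ ≃o ℝ)
  | .nil => 1
  | .node c l r => h c * treeMap l * conjTranslate l.numLeaves (treeMap r)

/-- The transformation of the line given by a forest. -/
def forestMap : FreeForest S → (ℝ ≃o ℝ)
  | [] => 1
  | t :: f => treeMap h t * conjTranslate t.numLeaves (forestMap f)

@[simp] theorem forestMap_singleton (t : FreeTree S) : forestMap h [t] = treeMap h t := by
  simp [forestMap]

@[simp] theorem forestMap_replicate (n : ℕ) : forestMap h (List.replicate n .nil) = 1 := by
  induction n with
  | zero => rfl
  | succ n ih => simp [List.replicate_succ, forestMap, treeMap, ih]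

theorem forestMap_append (f g : FreeForest S) :
    forestMap h (f ++ g) = forestMap h f * conjTranslate (leaves f) (forestMap h g) := by
  induction f with
  | nil => simp [forestMap]
  | cons t f ih => simp [forestMap, ih, conjTranslate_add, mul_assoc]

theorem treeMap_mem (N : Subgroup (ℝ ≃o ℝ)) (hN : ∀ c, h c ∈ N)
    (hT : ∀ n : ℕ, translate n ∈ N) (t : FreeTree S) : treeMap h t ∈ N := by
  induction t with
  | nil => exact N.one_mem
  | node c l r ihl ihr =>
    rw [treeMap, conjTranslate_def, ← translate_inv]
    exact N.mul_mem (N.mul_mem (hN c) ihl)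
      (N.mul_mem (N.mul_mem (hT _) ihr) (N.inv_mem (hT _)))

theorem forestMap_mem (N : Subgroup (ℝ ≃o ℝ)) (hN : ∀ c, h c ∈ N)
    (hT : ∀ n : ℕ, translate n ∈ N) (f : FreeForest S) : forestMap h f ∈ N := by
  induction f with
  | nil => exact N.one_mem
  | cons t f ih =>
    rw [forestMap, conjTranslate_def, ← translate_inv]
    exact N.mul_mem (treeMap_mem h N hN hT t)
      (N.mul_mem (N.mul_mem (hT _) ih) (N.inv_mem (hT _)))

variable {h} (hh : ∀ c, TranslatesOutside (h c) 2 1)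
include hh

theorem translatesOutside_treeMap (t : FreeTree S) :
    TranslatesOutside (treeMap h t) t.numLeaves 1 := by
  induction t with
  | nil => exact .one 1
  | node c l r ihl ihr =>
    rw [treeMap, mul_assoc]
    exact (hh c).mul (ihl.tensor ihr)

theorem translatesOutside_forestMap (f : FreeForest S) :
    TranslatesOutside (forestMap h f) (leaves f) f.length := by
  induction f with
  | nil => exact .one 0
  | cons t f ih =>
    rw [leaves_cons, List.length_cons, add_comm f.length]
    exact (translatesOutside_treeMap hh t).tensor ih

/-- The part of `g` over the left subtree has to pass the action of the right subtree; `interchange`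
allows this and turns the shift by its leaves into the shift by its roots. -/
theorem treeMap_graft (t : FreeTree S) (g : FreeForest S) (hg : g.length = t.numLeaves) :
    treeMap h (graft t g) = treeMap h t * forestMap h g := by
  induction t generalizing g with
  | nil =>
    obtain ⟨s, rfl⟩ := List.length_eq_one_iff.1 hg
    simp [graft, treeMap]
  | node c l r ihl ihr =>
    simp only [BinaryTree.numLeaves] at hg
    have hl : (g.take l.numLeaves).length = l.numLeaves := by simp; omega
    have hr : (g.drop l.numLeaves).length = r.numLeaves := by simp; omega
    have hi := (translatesOutside_forestMap hh (g.take l.numLeaves)).interchange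
      (translatesOutside_treeMap hh r).apply_of_nonpos
    rw [hl] at hi
    rw [graft, treeMap, treeMap, numLeaves_graft _ _ hl, ihl _ hl, ihr _ hr, map_mul]
    conv_rhs => rw [← List.take_append_drop l.numLeaves g, forestMap_append]
    simp only [mul_assoc]
    rw [← mul_assoc (forestMap h (g.take l.numLeaves)), hi, mul_assoc]

theorem forestMap_stack (f g : FreeForest S) (hg : g.length = leaves f) :
    forestMap h (stack f g) = forestMap h f * forestMap h g := by
  induction f generalizing g with
  | nil =>
    obtain rfl := List.length_eq_zero_iff.1 hg
    simp [stack, forestMap]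
  | cons t f ih =>
    simp only [leaves_cons] at hg
    have hl : (g.take t.numLeaves).length = t.numLeaves := by simp; omega
    have hr : (g.drop t.numLeaves).length = leaves f := by simp; omega
    have hi := (translatesOutside_forestMap hh (g.take t.numLeaves)).interchange
      (translatesOutside_forestMap hh f).apply_of_nonpos
    rw [hl] at hi
    rw [stack, forestMap, forestMap, numLeaves_graft _ _ hl, treeMap_graft hh _ _ hl, ih _ hr,
      map_mul]
    conv_rhs => rw [← List.take_append_drop t.numLeaves g, forestMap_append]
    simp only [mul_assoc]
    rw [← mul_assoc (forestMap h (g.take t.numLeaves)), hi, mul_assoc]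

/-- The first tree can be read off from the action: the forest acts as that tree on `(-∞,
t.numLeaves]`, and `t.numLeaves` is the only point sent to `1`. -/
theorem forestMap_cons_inj {t s : FreeTree S} {f g : FreeForest S}
    (e : forestMap h (t :: f) = forestMap h (s :: g)) :
    t.numLeaves = s.numLeaves ∧ treeMap h t = treeMap h s ∧ forestMap h f = forestMap h g := by
  have key : ∀ (t : FreeTree S) (f : FreeForest S) (x : ℝ), x ≤ t.numLeaves →
      forestMap h (t :: f) x = treeMap h t x := by
    intro t f x hx
    rw [forestMap, RelIso.mul_apply, conjTranslate_apply,
      (translatesOutside_forestMap hh f).apply_of_nonpos _ (by linarith), sub_add_cancel]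
  have ht := key t f _ le_rfl
  have hs := key s g _ le_rfl
  rw [(translatesOutside_treeMap hh _).apply_right] at ht hs
  rw [e, ← hs] at ht
  have hn : t.numLeaves = s.numLeaves := by exact_mod_cast (forestMap h (s :: g)).injective ht
  have hT : treeMap h t = treeMap h s := by
    ext x
    rcases le_total x t.numLeaves with hx | hx
    · rw [← key t f x hx, e, key s g x (hn ▸ hx)]
    · rw [(translatesOutside_treeMap hh t).apply_of_ge x hx,
        (translatesOutside_treeMap hh s).apply_of_ge x (hn ▸ hx), hn]
  refine ⟨hn, hT, ?_⟩
  rw [forestMap, forestMap, hT, hn] at e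
  exact (MulAut.conj (translate s.numLeaves)).injective (mul_left_cancel e)

end TreeMap

theorem forestMap_eq_of_skeinEq {P : SkeinPresentation.{u}} {h : P.Colour → (ℝ ≃o ℝ)}
    (hh : ∀ c, TranslatesOutside (h c) 2 1)
    (hrel : ∀ s t, P.Rel s t → treeMap h s = treeMap h t) {f g : FreeForest P.Colour}
    (hfg : SkeinEq P f g) : forestMap h f = forestMap h g := by
  induction hfg with
  | rel s t hst => simpa using hrel s t hst
  | refl f => rfl
  | symm f g _ ih => exact ih.symm
  | trans f g k _ _ ih₁ ih₂ => exact ih₁.trans ih₂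
  | stack f f' g g' e e' _ _ ih₁ ih₂ =>
    rw [forestMap_stack hh _ _ e, forestMap_stack hh _ _ e', ih₁, ih₂]
  | append f f' g g' hf _ ih₁ ih₂ =>
    rw [forestMap_append, forestMap_append, ih₁, ih₂, hf.leaves_length.1]

/-! ### Roots of expanding transformations -/

/-- `Y` translates by `s` near `-∞`, fixes `[1, ∞)` pointwise and moves the points below `1` to the
right. -/
structure ContractsToOne (Y : ℝ ≃o ℝ) (s : ℕ) : Prop where
  pos : 0 < s
  apply_of_le : ∀ x : ℝ, x ≤ -s → Y x = x + s
  apply_of_ge : ∀ x : ℝ, 1 ≤ x → Y x = x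
  lt_apply : ∀ x : ℝ, x < 1 → x < Y x

namespace ContractsToOne

variable {Y : ℝ ≃o ℝ} {s : ℕ} (hY : ContractsToOne Y s)
include hY

theorem pow_lt_one (m : ℕ) {x : ℝ} (hx : x < 1) : (Y ^ m) x < 1 := by
  induction m with
  | zero => simpa
  | succ m ih =>
    rw [pow_succ', RelIso.mul_apply, ← hY.apply_of_ge 1 le_rfl]
    exact Y.strictMono ih

theorem inv_apply {z : ℝ} (hz : z ≤ 0) : Y⁻¹ z = z - s := by
  refine (OrderIso.symm_apply_eq Y).2 ?_
  rw [hY.apply_of_le _ (by linarith), sub_add_cancel]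

/-- The backward orbit of `x` decreases. If it were bounded below, its limit would be a fixed point
below `1`, and there is none. -/
theorem exists_inv_pow_le {x : ℝ} (hx : x < 1) (c : ℝ) : ∃ m : ℕ, (Y⁻¹ ^ m) x ≤ c := by
  have hit : ∀ m : ℕ, (Y⁻¹ ^ m) x = (Y⁻¹ : ℝ ≃o ℝ)^[m] x := by
    intro m
    induction m with
    | zero => rfl
    | succ m ih => rw [pow_succ', RelIso.mul_apply, ih, Function.iterate_succ_apply']
  have hle : Y⁻¹ x ≤ x := (OrderIso.symm_apply_le Y).2 (hY.lt_apply x hx).le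
  have hanti : Antitone fun m => (Y⁻¹ : ℝ ≃o ℝ)^[m] x :=
    Monotone.antitone_iterate_of_map_le (Y⁻¹ : ℝ ≃o ℝ).monotone hle
  rcases tendsto_atTop_of_antitone hanti with h | ⟨L, h⟩
  · obtain ⟨m, hm⟩ := (h.eventually (eventually_le_atBot c)).exists
    exact ⟨m, (hit m).trans_le hm⟩
  · have hfix : Y⁻¹ L = L :=
      isFixedPt_of_tendsto_iterate h (Y⁻¹ : ℝ ≃o ℝ).continuous.continuousAt
    have hL : L ≤ x := hanti.le_of_tendsto h 0
    have := hY.lt_apply L (hL.trans_lt hx)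
    rw [← (OrderIso.symm_apply_eq Y).1 hfix] at this
    exact absurd this (lt_irrefl _)

omit hY in
/-- The translation by `c`, conjugated by `Y ^ m`. -/
def conjPow (Y : ℝ ≃o ℝ) (c : ℝ) (m : ℕ) : ℝ ≃o ℝ := Y ^ m * translate c * Y⁻¹ ^ m

omit hY in
theorem conjPow_apply_pow (c : ℝ) (m : ℕ) (z : ℝ) :
    conjPow Y c m ((Y ^ m) z) = (Y ^ m) (z + c) := by
  rw [conjPow, RelIso.mul_apply, RelIso.mul_apply, ← RelIso.mul_apply (Y⁻¹ ^ m), inv_pow,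
    inv_mul_cancel, RelIso.one_apply, translate_apply]

/-- This stability makes the root well defined. If `z ≤ -1`, then `z - s` and `z - s + 1` both lie
in `(-∞, -s]`, where `Y` is the translation by `s`; so one more conjugation of the unit translation
by `Y` changes nothing at `z`. -/
theorem conjPow_eq_of_le {x : ℝ} {m k : ℕ} (hmk : m ≤ k) (hx : (Y⁻¹ ^ m) x ≤ -1) :
    (Y⁻¹ ^ k) x ≤ -1 ∧ conjPow Y 1 k x = conjPow Y 1 m x := by
  have hs : (1 : ℝ) ≤ s := by exact_mod_cast hY.pos
  induction k, hmk using Nat.le_induction with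
  | base => exact ⟨hx, rfl⟩
  | succ k _ ih =>
    obtain ⟨h1, h2⟩ := ih
    have h3 : (Y⁻¹ ^ (k + 1)) x = (Y⁻¹ ^ k) x - s := by
      rw [pow_succ', RelIso.mul_apply, hY.inv_apply (by linarith)]
    refine ⟨by rw [h3]; linarith, ?_⟩
    rw [← h2]
    simp only [conjPow, RelIso.mul_apply, translate_apply] at h3 ⊢
    rw [h3, pow_succ, RelIso.mul_apply, hY.apply_of_le _ (by linarith)]
    congr 1
    ring

theorem conjPow_eq {x : ℝ} {m k : ℕ} (hm : (Y⁻¹ ^ m) x ≤ -1) (hk : (Y⁻¹ ^ k) x ≤ -1) :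
    conjPow Y 1 m x = conjPow Y 1 k x := by
  rcases le_total m k with h | h
  · exact (hY.conjPow_eq_of_le h hm).2.symm
  · exact (hY.conjPow_eq_of_le h hk).2

omit hY in
theorem inv_pow_apply_pow (m : ℕ) (z : ℝ) : (Y⁻¹ ^ m) ((Y ^ m) z) = z := by
  rw [← RelIso.mul_apply, inv_pow, inv_mul_cancel, RelIso.one_apply]

omit hY in
theorem pow_apply_inv_pow (m : ℕ) (z : ℝ) : (Y ^ m) ((Y⁻¹ ^ m) z) = z := by
  rw [← RelIso.mul_apply, inv_pow, mul_inv_cancel, RelIso.one_apply]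

open Classical in
/-- The underlying function of the `s`-th root of `Y`. -/
noncomputable def rootFun (x : ℝ) : ℝ :=
  if hx : x < 1 then conjPow Y 1 (hY.exists_inv_pow_le hx (-1)).choose x else x

theorem rootFun_of_ge {x : ℝ} (hx : 1 ≤ x) : hY.rootFun x = x := by
  rw [rootFun, dif_neg hx.not_gt]

theorem lt_one_of_inv_pow_lt {x : ℝ} {m : ℕ} (hm : (Y⁻¹ ^ m) x < 1) : x < 1 := by
  have := hY.pow_lt_one m hm
  rwa [pow_apply_inv_pow] at this

theorem rootFun_eq {x : ℝ} {m : ℕ} (hm : (Y⁻¹ ^ m) x ≤ -1) :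
    hY.rootFun x = conjPow Y 1 m x := by
  have hx : x < 1 := hY.lt_one_of_inv_pow_lt (hm.trans_lt (by norm_num))
  rw [rootFun, dif_pos hx]
  exact hY.conjPow_eq (hY.exists_inv_pow_le hx (-1)).choose_spec hm

theorem rootFun_pow (m : ℕ) {z : ℝ} (hz : z ≤ -1) :
    hY.rootFun ((Y ^ m) z) = (Y ^ m) (z + 1) := by
  rw [hY.rootFun_eq (m := m) (by rwa [inv_pow_apply_pow]), conjPow_apply_pow]

theorem rootFun_lt_one {x : ℝ} (hx : x < 1) : hY.rootFun x < 1 := by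
  obtain ⟨m, hm⟩ := hY.exists_inv_pow_le hx (-1)
  rw [← pow_apply_inv_pow (Y := Y) m x, hY.rootFun_pow m hm]
  exact hY.pow_lt_one m (by linarith)

theorem strictMono_rootFun : StrictMono hY.rootFun := by
  intro x y hxy
  rcases lt_or_ge y 1 with hy | hy
  · obtain ⟨m, hm⟩ := hY.exists_inv_pow_le hy (-1)
    rw [hY.rootFun_eq hm, hY.rootFun_eq (((Y⁻¹ ^ m).strictMono hxy).le.trans hm)]
    exact (conjPow Y 1 m).strictMono hxy
  · rw [hY.rootFun_of_ge hy]
    rcases lt_or_ge x 1 with hx | hx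
    · exact (hY.rootFun_lt_one hx).trans_le hy
    · rwa [hY.rootFun_of_ge hx]

theorem surjective_rootFun : Function.Surjective hY.rootFun := by
  intro y
  rcases lt_or_ge y 1 with hy | hy
  -- The bound `0` suffices, as the preimage is found one unit further left and so at most `-1`.
  · obtain ⟨m, hm⟩ := hY.exists_inv_pow_le hy 0
    refine ⟨(Y ^ m) ((Y⁻¹ ^ m) y - 1), ?_⟩
    rw [hY.rootFun_pow m (by linarith), sub_add_cancel, pow_apply_inv_pow]
  · exact ⟨y, hY.rootFun_of_ge hy⟩

/-- The `s`-th root of `Y` that is the translation by `1` near `-∞`. -/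
noncomputable def root : ℝ ≃o ℝ :=
  hY.strictMono_rootFun.orderIsoOfSurjective _ hY.surjective_rootFun

theorem root_apply (x : ℝ) : hY.root x = hY.rootFun x := rfl

theorem root_apply_of_ge {x : ℝ} (hx : 1 ≤ x) : hY.root x = x := hY.rootFun_of_ge hx

theorem root_apply_of_le {x : ℝ} (hx : x ≤ -1) : hY.root x = x + 1 := hY.rootFun_pow 0 hx

/-- Pulling `x` back to `-2` instead of `-1` leaves room for a neighbourhood on which the same
exponent `m` serves. Local properties of the root are thereby inherited from words in `Y` and a
translation. -/
theorem root_eventuallyEq {x : ℝ} (hx : x < 1) :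
    ∃ m, hY.root =ᶠ[𝓝 x] conjPow Y 1 m := by
  obtain ⟨m, hm⟩ := hY.exists_inv_pow_le hx (-2)
  refine ⟨m, ?_⟩
  have hc : Tendsto (Y⁻¹ ^ m : ℝ ≃o ℝ) (𝓝 x) (𝓝 ((Y⁻¹ ^ m) x)) :=
    (Y⁻¹ ^ m).continuous.continuousAt
  filter_upwards [hc.eventually_le_const (hm.trans_lt (by norm_num : (-2 : ℝ) < -1))] with y hy
  exact hY.rootFun_eq hy

theorem root_pow : hY.root ^ s = Y := by
  ext x
  rcases lt_or_ge x 1 with hx | hx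
  -- Starting from at most `-s`, the first `s - 1` unit steps end at most at `-1`, so that
  -- `rootFun_pow` applies with the same `m` at each of the `s` steps.
  · obtain ⟨m, hm⟩ := hY.exists_inv_pow_le hx (-s)
    have key : ∀ j : ℕ, j ≤ s → (hY.root ^ j) x = (Y ^ m) ((Y⁻¹ ^ m) x + j) := by
      intro j hj
      induction j with
      | zero => rw [pow_zero, RelIso.one_apply, Nat.cast_zero, add_zero, pow_apply_inv_pow]
      | succ j ih =>
        have hj' : (j + 1 : ℝ) ≤ s := by exact_mod_cast hj
        rw [pow_succ', RelIso.mul_apply, ih (by omega), root_apply,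
          hY.rootFun_pow m (by linarith)]
        push_cast
        ring_nf
    rw [key s le_rfl, ← hY.apply_of_le _ hm, ← RelIso.mul_apply, ← pow_succ, pow_succ',
      RelIso.mul_apply, pow_apply_inv_pow]
  · rw [hY.apply_of_ge x hx]
    have key : ∀ j : ℕ, (hY.root ^ j) x = x := by
      intro j
      induction j with
      | zero => rfl
      | succ j ih => rw [pow_succ', RelIso.mul_apply, ih, hY.root_apply_of_ge hx]
    exact key s

end ContractsToOne

/-! ### The two carets -/

theorem strictMono_dyadicCaret : StrictMono fun x : ℝ => max (min x (x / 2)) (x - 1) :=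
  fun _ _ h => max_lt_max (min_lt_min h (by linarith)) (by linarith)

theorem surjective_dyadicCaret :
    Function.Surjective fun x : ℝ => max (min x (x / 2)) (x - 1) := by
  intro y
  dsimp only
  rcases le_total y 0 with h | h
  · exact ⟨y, by rw [min_eq_left (by linarith), max_eq_left (by linarith)]⟩
  rcases le_total y 1 with h' | h'
  · refine ⟨2 * y, ?_⟩
    rw [min_eq_right (by linarith), max_eq_left (by linarith)]
    ring
  · refine ⟨y + 1, ?_⟩
    rw [min_eq_right (by linarith), max_eq_right (by linarith)]
    ring

/-- The dyadic caret: `[0, 2]` is contracted to `[0, 1]` by the factor `2`. -/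
noncomputable def dyadicCaret : ℝ ≃o ℝ :=
  strictMono_dyadicCaret.orderIsoOfSurjective _ surjective_dyadicCaret

theorem dyadicCaret_apply (x : ℝ) : dyadicCaret x = max (min x (x / 2)) (x - 1) := rfl

theorem translatesOutside_dyadicCaret : TranslatesOutside dyadicCaret 2 1 := by
  refine ⟨fun x hx => ?_, fun x hx => ?_⟩
  · rw [dyadicCaret_apply, min_eq_left (by linarith), max_eq_left (by linarith)]
  · push_cast at hx ⊢
    rw [dyadicCaret_apply, min_eq_right (by linarith), max_eq_right (by linarith)]
    ring

/-- All colours act by the dyadic caret. -/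
noncomputable def dyadicTreeMap (y : BinaryTree Unit) : ℝ ≃o ℝ := treeMap (fun _ => dyadicCaret) y

theorem translatesOutside_dyadicTreeMap (y : BinaryTree Unit) :
    TranslatesOutside (dyadicTreeMap y) y.numLeaves 1 :=
  translatesOutside_treeMap (fun _ => translatesOutside_dyadicCaret) y

theorem treeMap_colourBy {S : Type u} (h : S → (ℝ ≃o ℝ)) (c : S) (y : BinaryTree Unit) :
    treeMap h (colourBy c y) = treeMap (fun _ => h c) y := by
  induction y with
  | nil => rfl
  | node _ l r ihl ihr =>
    change h c * treeMap h (colourBy c l) *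
      conjTranslate (colourBy c l).numLeaves (treeMap h (colourBy c r)) = _
    rw [ihl, ihr, numLeaves_colourBy]
    rfl

/-- A caret lowers a point by at most `1`, and a tree has one caret fewer than leaves. -/
theorem le_dyadicTreeMap (y : BinaryTree Unit) (x : ℝ) :
    x + 1 - y.numLeaves ≤ dyadicTreeMap y x := by
  induction y generalizing x with
  | nil => simp [dyadicTreeMap, treeMap]
  | node _ l r ihl ihr =>
    simp only [dyadicTreeMap, treeMap, RelIso.mul_apply, conjTranslate_apply] at *
    rw [dyadicCaret_apply]
    refine le_max_of_le_right ?_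
    have h1 := ihr (x - l.numLeaves)
    have h2 := ihl (treeMap (fun _ => dyadicCaret) r (x - l.numLeaves) + l.numLeaves)
    simp only [BinaryTree.numLeaves]
    push_cast
    linarith

/-- Points to the left of the last leaf's right end reach the root caret below `2`, where that caret
lowers them by strictly less than `1`. This becomes the absence of fixed points below `1` for the
map whose root is taken. -/
theorem lt_dyadicTreeMap {y : BinaryTree Unit} (hy : 2 ≤ y.numLeaves) {x : ℝ}
    (hx : x < y.numLeaves) : x + 1 - y.numLeaves < dyadicTreeMap y x := by
  cases y with
  | nil => simp at hy
  | node u l r =>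
    set w := (treeMap (fun _ => dyadicCaret) l * conjTranslate l.numLeaves
      (treeMap (fun _ => dyadicCaret) r)) x with hw
    have hs : TranslatesOutside (treeMap (fun _ => dyadicCaret) l * conjTranslate l.numLeaves
        (treeMap (fun _ => dyadicCaret) r)) (l.numLeaves + r.numLeaves) 2 :=
      (translatesOutside_dyadicTreeMap l).tensor (translatesOutside_dyadicTreeMap r)
    have hw2 : w < 2 := by
      have := (treeMap (fun _ => dyadicCaret) l * conjTranslate l.numLeaves
        (treeMap (fun _ => dyadicCaret) r)).strictMono hx
      have h2 := hs.apply_right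
      simp only [BinaryTree.numLeaves] at this
      rw [h2] at this
      exact_mod_cast this
    have hle : x + 2 - (l.numLeaves + r.numLeaves : ℕ) ≤ w := by
      have h1 := le_dyadicTreeMap r (x - l.numLeaves)
      have h2 := le_dyadicTreeMap l (dyadicTreeMap r (x - l.numLeaves) + l.numLeaves)
      simp only [hw, RelIso.mul_apply, conjTranslate_apply]
      push_cast
      simp only [dyadicTreeMap] at h1 h2 ⊢
      linarith
    have hd : w - 1 < dyadicCaret w := by
      rw [dyadicCaret_apply]
      exact lt_max_of_lt_left (lt_min (by linarith) (by linarith))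
    have : dyadicTreeMap (.node u l r) x = dyadicCaret w := by
      rw [dyadicTreeMap, treeMap, mul_assoc, RelIso.mul_apply, hw]
    rw [this]
    simp only [BinaryTree.numLeaves]
    linarith

/-- Shifting by the number of carets, one less than the number of leaves, moves `1` to the right end
of the last leaf, which the tree sends back to `1`; beyond it the two translations cancel. -/
theorem contractsToOne_dyadicTreeMap {x : BinaryTree Unit} (hx : 2 ≤ x.numLeaves) :
    ContractsToOne (dyadicTreeMap x * translate x.numNodes) x.numNodes := by
  have hn := x.numLeaves_eq_numNodes_succ
  have hn' : (x.numLeaves : ℝ) = x.numNodes + 1 := by exact_mod_cast hn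
  have ht := translatesOutside_dyadicTreeMap x
  refine ⟨by omega, fun z hz => ?_, fun z hz => ?_, fun z hz => ?_⟩ <;>
    rw [RelIso.mul_apply, translate_apply]
  · exact ht.apply_of_nonpos _ (by linarith)
  · rw [ht.apply_of_ge _ (by linarith), hn']
    push_cast
    ring
  · have := lt_dyadicTreeMap hx (x := z + x.numNodes) (by linarith)
    linarith

/-- The caret whose right-vine acts in the same way as the dyadic tree `x`. -/
noncomputable def vineCaret {x : BinaryTree Unit} (hx : 2 ≤ x.numLeaves) : ℝ ≃o ℝ :=
  (contractsToOne_dyadicTreeMap hx).root * translate (-1)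

theorem translatesOutside_vineCaret {x : BinaryTree Unit} (hx : 2 ≤ x.numLeaves) :
    TranslatesOutside (vineCaret hx) 2 1 := by
  refine ⟨fun z hz => ?_, fun z hz => ?_⟩ <;> rw [vineCaret, RelIso.mul_apply, translate_apply]
  · rw [ContractsToOne.root_apply_of_le _ (by linarith)]
    ring
  · push_cast at hz ⊢
    rw [ContractsToOne.root_apply_of_ge _ (by linarith)]
    ring

/-- The product telescopes: in each caret the `translate (-1)` cancels the shift by the one leaf on
its left. The skein relation thus turns into an equation for `R ^ k`. -/
theorem treeMap_rightVine (R : ℝ ≃o ℝ) (k : ℕ) :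
    treeMap (fun _ => R * translate (-1)) (rightVine k) = R ^ k * translate (-k) := by
  induction k with
  | zero => simp [rightVine, treeMap]
  | succ k ih =>
    rw [rightVine, treeMap, ih, treeMap, conjTranslate_def]
    simp only [BinaryTree.numLeaves, Nat.cast_one, mul_one, mul_assoc, pow_succ']
    rw [translate_mul, ← mul_assoc (translate (-1)) (translate 1), translate_mul]
    simp only [neg_add_cancel, translate_zero, one_mul]
    push_cast
    rw [neg_add]

/-- The actions of the two colours of the presentation `⟨a, b | x(a) = ρ(b)⟩`. -/
noncomputable def caretMap {x : BinaryTree Unit} (hx : 2 ≤ x.numLeaves) : TwoColours → (ℝ ≃o ℝ)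
  | .a => dyadicCaret
  | .b => vineCaret hx

theorem translatesOutside_caretMap {x : BinaryTree Unit} (hx : 2 ≤ x.numLeaves) (c : TwoColours) :
    TranslatesOutside (caretMap hx c) 2 1 := by
  cases c
  · exact translatesOutside_dyadicCaret
  · exact translatesOutside_vineCaret hx

theorem treeMap_caretMap_eq {x : BinaryTree Unit} (hx : 2 ≤ x.numLeaves) :
    treeMap (caretMap hx) (colourBy .a x) =
      treeMap (caretMap hx) (colourBy .b (rightVine x.numNodes)) := by
  rw [treeMap_colourBy, treeMap_colourBy]
  change dyadicTreeMap x = treeMap (fun _ => vineCaret hx) _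
  simp only [vineCaret]
  rw [treeMap_rightVine, ContractsToOne.root_pow, mul_assoc, translate_mul, add_neg_cancel,
    translate_zero, mul_one]

/-! ### Piecewise linear transformations -/

/-- Along the filter `l`, `f` is affine about `x` with slope a power of two. -/
def AffineAlong (f : ℝ → ℝ) (x : ℝ) (l : Filter ℝ) : Prop :=
  ∃ k : ℤ, ∀ᶠ y in l, f y = f x + 2 ^ k * (y - x)

namespace AffineAlong

variable {f g : ℝ → ℝ} {x : ℝ} {l l' : Filter ℝ}

theorem of_eventuallyEq (k : ℤ) (c : ℝ) (hl : ∀ᶠ y in l, f y = 2 ^ k * y + c)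
    (hx : f x = 2 ^ k * x + c) : AffineAlong f x l := by
  refine ⟨k, hl.mono fun y hy => ?_⟩
  rw [hy, hx]
  ring

theorem congr (hf : AffineAlong f x l) (h : g =ᶠ[l] f) (hx : g x = f x) :
    AffineAlong g x l := by
  obtain ⟨k, hk⟩ := hf
  refine ⟨k, ?_⟩
  filter_upwards [h, hk] with y h1 h2
  rw [h1, h2, hx]

theorem comp (hf : AffineAlong f (g x) l') (hg : AffineAlong g x l) (h : Tendsto g l l') :
    AffineAlong (f ∘ g) x l := by
  obtain ⟨k, hk⟩ := hf
  obtain ⟨j, hj⟩ := hg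
  refine ⟨k + j, ?_⟩
  filter_upwards [hj, h.eventually hk] with y h1 h2
  rw [Function.comp_apply, Function.comp_apply, h2, h1, zpow_add₀ (by norm_num)]
  ring

theorem symm {f : ℝ ≃o ℝ} {y : ℝ} (hf : AffineAlong f (f.symm y) l)
    (h : Tendsto f.symm l' l) : AffineAlong f.symm y l' := by
  obtain ⟨k, hk⟩ := hf
  refine ⟨-k, ?_⟩
  filter_upwards [h.eventually hk] with w hw
  rw [f.apply_symm_apply, f.apply_symm_apply] at hw
  have hpos : (0 : ℝ) < 2 ^ k := by positivity
  have h' : w - y = 2 ^ k * (f.symm w - f.symm y) := by linarith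
  rw [h', zpow_neg, inv_mul_cancel_left₀ hpos.ne']
  ring

theorem hasDerivAt (hf : AffineAlong f x (𝓝 x)) : ∃ k : ℤ, HasDerivAt f (2 ^ k) x := by
  obtain ⟨k, hk⟩ := hf
  have h2 : HasDerivAt (fun z => f x + 2 ^ k * (z - x)) ((2 : ℝ) ^ k) x := by
    simpa using (((hasDerivAt_id x).sub_const x).const_mul ((2 : ℝ) ^ k)).const_add (f x)
  exact ⟨k, h2.congr_of_eventuallyEq hk⟩

theorem rightAffine (hf : AffineAlong f x (𝓝[≥] x)) : RightAffine f x := by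
  obtain ⟨k, hk⟩ := hf
  obtain ⟨q, hq, h⟩ := mem_nhdsGE_iff_exists_Ico_subset.1 hk
  exact ⟨k, q, hq, fun y hy => h hy⟩

end AffineAlong

theorem tendsto_nhdsGE (f : ℝ ≃o ℝ) (x : ℝ) : Tendsto f (𝓝[≥] x) (𝓝[≥] (f x)) :=
  f.continuous.continuousWithinAt.tendsto_nhdsWithin fun _ hy => f.monotone hy

theorem tendsto_nhdsLE (f : ℝ ≃o ℝ) (x : ℝ) : Tendsto f (𝓝[≤] x) (𝓝[≤] (f x)) :=
  f.continuous.continuousWithinAt.tendsto_nhdsWithin fun _ hy => f.monotone hy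

/-- `f` is piecewise linear with slopes powers of two and dyadic breakpoints, and its pieces
accumulate at finitely many points, and there only from the left. -/
structure IsRightPL (f : ℝ ≃o ℝ) : Prop where
  right : ∀ x, AffineAlong f x (𝓝[≥] x)
  left : {x | ¬ AffineAlong f x (𝓝[≤] x)}.Finite
  mem_dyadics : ∀ x, f x ∈ dyadics ↔ x ∈ dyadics
  affine : ∀ x ∉ dyadics, AffineAlong f x (𝓝 x)

namespace IsRightPL

variable {f g : ℝ ≃o ℝ}

theorem one : IsRightPL 1 := by
  have h : ∀ x l, AffineAlong (1 : ℝ ≃o ℝ) x l := fun x l =>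
    .of_eventuallyEq 0 0 (by simp) (by simp)
  exact ⟨fun x => h x _, Set.finite_empty.subset fun x hx => hx (h x _), fun x => Iff.rfl,
    fun x _ => h x _⟩

theorem left_mul {x : ℝ} (hf : AffineAlong f (g x) (𝓝[≤] (g x))) (hg : AffineAlong g x (𝓝[≤] x)) :
    AffineAlong (f * g : ℝ ≃o ℝ) x (𝓝[≤] x) :=
  hf.comp hg (tendsto_nhdsLE g x)

theorem mul (hf : IsRightPL f) (hg : IsRightPL g) : IsRightPL (f * g) := by
  refine ⟨fun x => (hf.right _).comp (hg.right x) (tendsto_nhdsGE g x), ?_, fun x =>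
    (hf.mem_dyadics _).trans (hg.mem_dyadics x), fun x hx => (hf.affine _
      ((hg.mem_dyadics x).not.2 hx)).comp (hg.affine x hx) g.continuous.continuousAt⟩
  refine (hg.left.union (hf.left.preimage g.injective.injOn)).subset fun x hx => ?_
  by_contra h
  rw [Set.mem_union, not_or] at h
  exact hx (left_mul (not_not.1 h.2) (not_not.1 h.1))

theorem inv (hf : IsRightPL f) : IsRightPL f⁻¹ := by
  change IsRightPL f.symm
  have hd : ∀ x, f.symm x ∈ dyadics ↔ x ∈ dyadics := fun x => by
    rw [← hf.mem_dyadics, f.apply_symm_apply]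
  refine ⟨fun x => (hf.right _).symm (tendsto_nhdsGE _ x), ?_, hd, fun x hx =>
    (hf.affine _ ((hd x).not.2 hx)).symm f.symm.continuous.continuousAt⟩
  refine (hf.left.preimage f.symm.injective.injOn).subset fun x hx h => ?_
  exact hx (h.symm (tendsto_nhdsLE _ x))

end IsRightPL

/-- The group of right piecewise linear transformations of the line. -/
def rightPL : Subgroup (ℝ ≃o ℝ) where
  carrier := {f | IsRightPL f}
  one_mem' := .one
  mul_mem' := .mul
  inv_mem' := .inv

/-- The right piecewise linear transformations whose pieces do not accumulate. -/
def finitePL : Subgroup (ℝ ≃o ℝ) where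
  carrier := {f | IsRightPL f ∧ ∀ x, AffineAlong f x (𝓝[≤] x)}
  one_mem' := ⟨.one, fun x => .of_eventuallyEq 0 0 (by simp) (by simp)⟩
  mul_mem' := fun hf hg => ⟨hf.1.mul hg.1, fun x => IsRightPL.left_mul (hf.2 _) (hg.2 x)⟩
  inv_mem' := fun hf => ⟨hf.1.inv, fun _ => (hf.2 _).symm (tendsto_nhdsLE _ _)⟩

/-! ### Translations, carets and roots are piecewise linear -/

theorem int_mem_dyadics (n : ℤ) : (n : ℝ) ∈ dyadics := ⟨n, 0, by simp⟩

theorem zpow_mul_mem_dyadics_iff (k : ℤ) {x : ℝ} : 2 ^ k * x ∈ dyadics ↔ x ∈ dyadics := by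
  refine ⟨fun h => ?_, zpow_mul_dyadic k⟩
  have := zpow_mul_dyadic (-k) h
  rwa [← mul_assoc, ← zpow_add₀ (by norm_num), neg_add_cancel, zpow_zero, one_mul] at this

theorem add_int_mem_dyadics_iff (n : ℤ) {x : ℝ} : x + n ∈ dyadics ↔ x ∈ dyadics := by
  refine ⟨fun h => ?_, fun h => ?_⟩
  · simpa using sub_dyadic h (int_mem_dyadics n)
  · simpa using sub_dyadic h (int_mem_dyadics (-n))

theorem affine_mem_dyadics_iff (k n : ℤ) {x : ℝ} : 2 ^ k * x + n ∈ dyadics ↔ x ∈ dyadics := by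
  rw [add_int_mem_dyadics_iff, zpow_mul_mem_dyadics_iff]

theorem translate_mem_finitePL (n : ℤ) : translate n ∈ finitePL := by
  have h : ∀ x l, AffineAlong (translate n) x l := fun x l =>
    .of_eventuallyEq 0 n (by simp) (by simp)
  exact ⟨⟨fun x => h x _, by simp [h], fun x => add_int_mem_dyadics_iff n, fun x _ => h x _⟩,
    fun x => h x _⟩

theorem dyadicCaret_mem_finitePL : dyadicCaret ∈ finitePL := by
  have h1 : ∀ y : ℝ, y ≤ 0 → dyadicCaret y = 2 ^ (0 : ℤ) * y + (0 : ℤ) := fun y hy => by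
    rw [dyadicCaret_apply, min_eq_left (by linarith), max_eq_left (by linarith)]
    simp
  have h2 : ∀ y : ℝ, 0 ≤ y → y ≤ 2 → dyadicCaret y = 2 ^ (-1 : ℤ) * y + (0 : ℤ) :=
    fun y hy hy' => by
      rw [dyadicCaret_apply, min_eq_right (by linarith), max_eq_left (by linarith), zpow_neg_one]
      push_cast
      ring
  have h3 : ∀ y : ℝ, 2 ≤ y → dyadicCaret y = 2 ^ (0 : ℤ) * y + (-1 : ℤ) := fun y hy => by
    rw [dyadicCaret_apply, min_eq_right (by linarith), max_eq_right (by linarith)]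
    push_cast
    ring
  have hl : ∀ x, AffineAlong dyadicCaret x (𝓝[≤] x) := by
    intro x
    rcases le_or_gt x 0 with h | h
    · refine .of_eventuallyEq _ _ ?_ (h1 x h)
      filter_upwards [self_mem_nhdsWithin] with y hy using h1 y (hy.trans h)
    · rcases le_or_gt x 2 with h' | h'
      · refine .of_eventuallyEq _ _ ?_ (h2 x h.le h')
        filter_upwards [self_mem_nhdsWithin, mem_nhdsWithin_of_mem_nhds (Ioi_mem_nhds h)]
          with y hy hy' using h2 y hy'.le (hy.trans h')
      · refine .of_eventuallyEq _ _ ?_ (h3 x h'.le)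
        filter_upwards [mem_nhdsWithin_of_mem_nhds (Ioi_mem_nhds h')] with y hy using h3 y hy.le
  refine ⟨⟨fun x => ?_, by simp [hl], fun x => ?_, fun x hx => ?_⟩, hl⟩
  · rcases lt_or_ge x 0 with h | h
    · refine .of_eventuallyEq _ _ ?_ (h1 x h.le)
      filter_upwards [mem_nhdsWithin_of_mem_nhds (Iio_mem_nhds h)] with y hy using h1 y hy.le
    · rcases lt_or_ge x 2 with h' | h'
      · refine .of_eventuallyEq _ _ ?_ (h2 x h h'.le)
        filter_upwards [self_mem_nhdsWithin, mem_nhdsWithin_of_mem_nhds (Iio_mem_nhds h')]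
          with y hy hy' using h2 y (h.trans hy) hy'.le
      · refine .of_eventuallyEq _ _ ?_ (h3 x h')
        filter_upwards [self_mem_nhdsWithin] with y hy using h3 y (h'.trans hy)
  · rcases le_total x 0 with h | h
    · rw [h1 x h, affine_mem_dyadics_iff]
    · rcases le_total x 2 with h' | h'
      · rw [h2 x h h', affine_mem_dyadics_iff]
      · rw [h3 x h', affine_mem_dyadics_iff]
  · have hx0 : x ≠ 0 := fun h => hx (h ▸ by simpa using int_mem_dyadics 0)
    have hx2 : x ≠ 2 := fun h => hx (h ▸ by simpa using int_mem_dyadics 2)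
    rcases lt_or_gt_of_ne hx0 with h | h
    · refine .of_eventuallyEq _ _ ?_ (h1 x h.le)
      filter_upwards [Iio_mem_nhds h] with y hy using h1 y hy.le
    · rcases lt_or_gt_of_ne hx2 with h' | h'
      · refine .of_eventuallyEq _ _ ?_ (h2 x h.le h'.le)
        filter_upwards [Ioo_mem_nhds h h'] with y hy using h2 y hy.1.le hy.2.le
      · refine .of_eventuallyEq _ _ ?_ (h3 x h'.le)
        filter_upwards [Ioi_mem_nhds h'] with y hy using h3 y hy.le

/-- Below `1` the root agrees locally with a conjugate of a translation, and from `1` on it is the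
identity, so `1` is the only possible accumulation point. For this `Y` has to lie in `finitePL`: the
conjugates then have an affine left germ everywhere. -/
theorem ContractsToOne.root_mem_rightPL {Y : ℝ ≃o ℝ} {s : ℕ} (hY : ContractsToOne Y s)
    (hf : Y ∈ finitePL) : hY.root ∈ rightPL := by
  have hc : ∀ m, conjPow Y 1 m ∈ finitePL := fun m =>
    finitePL.mul_mem (finitePL.mul_mem (finitePL.pow_mem hf m)
      (by simpa using translate_mem_finitePL 1)) (finitePL.pow_mem (finitePL.inv_mem hf) m)
  have hid : ∀ x : ℝ, 1 ≤ x → hY.root x = 2 ^ (0 : ℤ) * x + 0 := fun x hx => by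
    simp [hY.root_apply_of_ge hx]
  refine ⟨fun x => ?_, (Set.finite_singleton 1).subset fun x hx => ?_, fun x => ?_,
    fun x hx => ?_⟩
  · rcases lt_or_ge x 1 with h | h
    · obtain ⟨m, hm⟩ := hY.root_eventuallyEq h
      exact ((hc m).1.right x).congr (hm.filter_mono nhdsWithin_le_nhds) hm.eq_of_nhds
    · refine .of_eventuallyEq _ _ ?_ (hid x h)
      filter_upwards [self_mem_nhdsWithin] with y hy using hid y (h.trans hy)
  · by_contra h
    rcases lt_or_gt_of_ne h with h | h
    · obtain ⟨m, hm⟩ := hY.root_eventuallyEq h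
      exact hx (((hc m).2 x).congr (hm.filter_mono nhdsWithin_le_nhds) hm.eq_of_nhds)
    · refine hx (.of_eventuallyEq _ _ ?_ (hid x h.le))
      filter_upwards [mem_nhdsWithin_of_mem_nhds (Ioi_mem_nhds h)] with y hy using hid y hy.le
  · rcases lt_or_ge x 1 with h | h
    · obtain ⟨m, hm⟩ := hY.root_eventuallyEq h
      rw [hm.eq_of_nhds]
      exact (hc m).1.mem_dyadics x
    · rw [hY.root_apply_of_ge h]
  · have hx1 : x ≠ 1 := fun h => hx (h ▸ by simpa using int_mem_dyadics 1)
    rcases lt_or_gt_of_ne hx1 with h | h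
    · obtain ⟨m, hm⟩ := hY.root_eventuallyEq h
      exact ((hc m).1.affine x hx).congr hm hm.eq_of_nhds
    · refine .of_eventuallyEq _ _ ?_ (hid x h.le)
      filter_upwards [Ioi_mem_nhds h] with y hy using hid y hy.le

theorem finitePL_le_rightPL : finitePL ≤ rightPL := fun _ hf => hf.1

theorem caretMap_mem_rightPL {x : BinaryTree Unit} (hx : 2 ≤ x.numLeaves) (c : TwoColours) :
    caretMap hx c ∈ rightPL := by
  cases c
  · exact finitePL_le_rightPL dyadicCaret_mem_finitePL
  · refine rightPL.mul_mem (ContractsToOne.root_mem_rightPL _ (finitePL.mul_mem ?_ ?_))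
      (finitePL_le_rightPL (by simpa using translate_mem_finitePL (-1)))
    · exact treeMap_mem _ finitePL (fun _ => dyadicCaret_mem_finitePL)
        (fun n => by simpa using translate_mem_finitePL n) x
    · simpa using translate_mem_finitePL x.numNodes

/-! ### Periodic extension -/

/-- The transformations of the line supported in `[0, 1]`. -/
def unitSupported : Subgroup (ℝ ≃o ℝ) where
  carrier := {f | TranslatesOutside f 1 1}
  one_mem' := .one 1
  mul_mem' := .mul
  inv_mem' := .inv

theorem fract_mem_of_unitSupported {f : ℝ ≃o ℝ} (hf : f ∈ unitSupported) (x : ℝ) :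
    0 ≤ f (Int.fract x) ∧ f (Int.fract x) < 1 := by
  have h0 : f 0 = 0 := TranslatesOutside.apply_of_nonpos hf 0 le_rfl
  have h1 : f 1 = 1 := by simpa using TranslatesOutside.apply_right hf
  constructor
  · conv_lhs => rw [← h0]
    exact f.monotone (Int.fract_nonneg x)
  · conv_rhs => rw [← h1]
    exact f.strictMono (Int.fract_lt_one x)

theorem floor_fract_periodize {f : ℝ ≃o ℝ} (hf : f ∈ unitSupported) (x : ℝ) :
    ⌊⌊x⌋ + f (Int.fract x)⌋ = ⌊x⌋ ∧ Int.fract (⌊x⌋ + f (Int.fract x)) = f (Int.fract x) := by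
  have h := fract_mem_of_unitSupported hf x
  have h1 : ⌊⌊x⌋ + f (Int.fract x)⌋ = ⌊x⌋ := by
    rw [Int.floor_intCast_add, Int.floor_eq_zero_iff.2 h, add_zero]
  refine ⟨h1, ?_⟩
  rw [Int.fract_intCast_add, Int.fract_eq_self.2 h]

/-- The periodic extension of a transformation supported in `[0, 1]`. -/
noncomputable def periodizeIso (f : unitSupported) : ℝ ≃o ℝ where
  toFun x := ⌊x⌋ + f.1 (Int.fract x)
  invFun x := ⌊x⌋ + f.1⁻¹ (Int.fract x)
  left_inv x := by
    dsimp only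
    obtain ⟨h1, h2⟩ := floor_fract_periodize f.2 x
    rw [h1, h2, ← RelIso.mul_apply, inv_mul_cancel, RelIso.one_apply, Int.floor_add_fract]
  right_inv x := by
    dsimp only
    obtain ⟨h1, h2⟩ := floor_fract_periodize (unitSupported.inv_mem f.2) x
    rw [h1, h2, ← RelIso.mul_apply, mul_inv_cancel, RelIso.one_apply, Int.floor_add_fract]
  map_rel_iff' {x y} := by
    have hm : StrictMono fun x : ℝ => ⌊x⌋ + f.1 (Int.fract x) := by
      intro x y h
      rcases (Int.floor_mono h.le).eq_or_lt with e | e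
      · have : Int.fract x < Int.fract y := by
          rw [Int.fract, Int.fract, e]
          linarith
        have := f.1.strictMono this
        simp only [e]
        linarith
      · have h1 := fract_mem_of_unitSupported f.2 x
        have h2 := fract_mem_of_unitSupported f.2 y
        have : (⌊x⌋ + 1 : ℝ) ≤ ⌊y⌋ := by exact_mod_cast e
        dsimp only
        linarith
    exact hm.le_iff_le

theorem periodizeIso_apply (f : unitSupported) (x : ℝ) :
    periodizeIso f x = ⌊x⌋ + f.1 (Int.fract x) := rfl

/-- Both endpoints are allowed because `f` fixes `0` and `1`, so adjacent copies agree where they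
meet. -/
theorem periodizeIso_eq (f : unitSupported) (k : ℤ) {x : ℝ} (h : (k : ℝ) ≤ x) (h' : x ≤ k + 1) :
    periodizeIso f x = conjTranslate k f.1 x := by
  have h1 : f.1 1 = 1 := by simpa using TranslatesOutside.apply_right f.2
  have h0 : f.1 0 = 0 := TranslatesOutside.apply_of_nonpos f.2 0 le_rfl
  rw [periodizeIso_apply, conjTranslate_apply]
  rcases h'.eq_or_lt with rfl | h'
  · simp [h0, h1, add_comm]
  · have hf : ⌊x⌋ = k := Int.floor_eq_iff.2 ⟨h, h'⟩
    rw [Int.fract, hf, add_comm]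

theorem isInfinitePL_periodizeIso (f : unitSupported) (hf : f.1 ∈ rightPL) :
    IsInfinitePL (periodizeIso f) := by
  have hk : ∀ k : ℤ, IsRightPL (conjTranslate k f.1) := fun k => by
    rw [conjTranslate_def]
    exact rightPL.mul_mem (rightPL.mul_mem (finitePL_le_rightPL (translate_mem_finitePL k)) hf)
      (finitePL_le_rightPL (by simpa using translate_mem_finitePL (-k)))
  have heq : ∀ x, periodizeIso f x = conjTranslate ⌊x⌋ f.1 x := fun x =>
    periodizeIso_eq f _ (Int.floor_le x) (Int.lt_floor_add_one x).le
  have hR : ∀ x, AffineAlong (periodizeIso f) x (𝓝[≥] x) := fun x => by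
    refine ((hk ⌊x⌋).right x).congr ?_ (heq x)
    filter_upwards [self_mem_nhdsWithin,
      mem_nhdsWithin_of_mem_nhds (Iio_mem_nhds (Int.lt_floor_add_one x))] with y hy hy'
    exact periodizeIso_eq f _ ((Int.floor_le x).trans hy) hy'.le
  have hev : ∀ x, (⌊x⌋ : ℝ) ≠ x → periodizeIso f =ᶠ[𝓝 x] conjTranslate ⌊x⌋ f.1 := fun x hx => by
    filter_upwards [Ioo_mem_nhds (lt_of_le_of_ne (Int.floor_le x) hx)
      (Int.lt_floor_add_one x)] with y hy
    exact periodizeIso_eq f _ hy.1.le hy.2.le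
  have hD : ∀ x ∉ dyadics, ∃ k : ℤ, HasDerivAt (periodizeIso f) (2 ^ k) x := fun x hx => by
    have h := hev x fun h => hx (h ▸ int_mem_dyadics _)
    exact (((hk ⌊x⌋).affine x hx).congr h h.eq_of_nhds).hasDerivAt
  refine ⟨?_, fun x => ?_, ?_, fun p _ => (hR p).rightAffine.acc_left, fun x hx => ?_,
    fun x hx => ?_, fun x hx => (hR x).rightAffine.slope hx⟩
  · simpa [periodizeIso_apply] using TranslatesOutside.apply_of_nonpos f.2 0 le_rfl
  · simp only [periodizeIso_apply, Int.floor_add_one, Int.fract_add_one]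
    push_cast
    ring
  -- The point `0` is set aside because the pieces of the copy on `[-1, 0]` may accumulate there. At
  -- any other point of `[0, 1)`, affine germs on both sides exclude accumulation.
  · refine ((Set.finite_singleton (0 : ℝ)).union (hk 0).left).subset ?_
    rintro p ⟨hp, hacc⟩
    by_contra hn
    simp only [Set.mem_union, Set.mem_singleton_iff, Set.mem_ofPred_eq, not_or, not_not] at hn
    obtain ⟨hp0, k, hleft⟩ := hn
    have hfl : ⌊p⌋ = 0 := Int.floor_eq_zero_iff.2 hp
    have h := hev p (by simpa [hfl] using Ne.symm hp0)
    rw [hfl] at h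
    have hL : ∀ᶠ y in 𝓝[≤] p, periodizeIso f y = periodizeIso f p + 2 ^ k * (y - p) := by
      filter_upwards [hleft, h.filter_mono nhdsWithin_le_nhds] with y h1 h2
      rw [h2, h.eq_of_nhds, h1]
    obtain ⟨q, hq, hL⟩ := mem_nhdsLE_iff_exists_Ioc_subset.1 hL
    obtain ⟨r, hr, hB⟩ := (hR p).rightAffine.acc_left
    rw [accPt_iff_nhds] at hacc
    obtain ⟨y, ⟨hyI, hyB⟩, hne⟩ := hacc _ (Ioo_mem_nhds hq hr)
    rcases lt_or_gt_of_ne hne with hlt | hgt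
    · refine hyB (AffineAlong.hasDerivAt (.of_eventuallyEq k (periodizeIso f p - 2 ^ k * p) ?_ ?_)
        |>.choose_spec.differentiableAt)
      · filter_upwards [Ioo_mem_nhds hyI.1 hlt] with z hz
        rw [hL ⟨hz.1, hz.2.le⟩]
        ring
      · rw [hL ⟨hyI.1, hlt.le⟩]
        ring
    · exact Set.notMem_empty y (hB ▸ ⟨⟨hgt, hyI.2⟩, hyB⟩)
  · by_contra hn
    obtain ⟨k, hk⟩ := hD x hn
    exact hx hk.differentiableAt
  · rw [heq x]
    exact ((hk _).mem_dyadics x).2 hx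

/-- Periodic extension as a homomorphism to `𝓘F`. -/
noncomputable def periodize : ↥(unitSupported ⊓ rightPL) →* InfinitePLGroup where
  toFun f := ⟨periodizeIso ⟨f.1, f.2.1⟩, isInfinitePL_periodizeIso _ f.2.2⟩
  map_one' := by
    ext x
    exact Int.floor_add_fract x
  map_mul' f g := by
    ext x
    obtain ⟨h1, h2⟩ := floor_fract_periodize g.2.1 x
    change _ = (⌊⌊x⌋ + g.1 (Int.fract x)⌋ : ℝ) + f.1 (Int.fract (⌊x⌋ + g.1 (Int.fract x)))
    rw [h1, h2]
    rfl

theorem injective_periodize : Function.Injective periodize := by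
  rw [injective_iff_map_eq_one]
  intro f hf
  refine Subtype.ext (RelIso.ext fun x => ?_)
  have hu : TranslatesOutside f.1 1 1 := f.2.1
  rcases le_total x 0 with h | h
  · exact hu.apply_of_nonpos x h
  rcases le_total x 1 with h' | h'
  · have h1 := periodizeIso_eq ⟨f.1, f.2.1⟩ 0 (x := x) (by simpa) (by simpa)
    have h2 : periodizeIso ⟨f.1, f.2.1⟩ x = x := DFunLike.congr_fun (congrArg Subtype.val hf) x
    rw [h2] at h1
    simpa using h1.symm
  · simpa using hu.apply_of_ge x (by simpa)

/-! ### Common multiples -/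

/-- The number of vertices on the right side of a tree. -/
def rightDepth {S : Type u} : FreeTree S → ℕ
  | .nil => 0
  | .node _ _ r => rightDepth r + 1

theorem graft_node_append {S : Type u} (c : S) (l r : FreeTree S) (f g : FreeForest S)
    (hf : f.length = l.numLeaves) :
    graft (.node c l r) (f ++ g) = .node c (graft l f) (graft r g) := by
  rw [graft, List.take_left' hf, List.drop_left' hf]

theorem stack_singleton {S : Type u} (t : FreeTree S) (g : FreeForest S)
    (hg : g.length = t.numLeaves) : stack [t] g = [graft t g] := by
  simp [stack, ← hg]

/-- Superposing two trees of one colour gives a common refinement. The tree `y` over the last leaf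
of `x` is singled out because its smaller right depth drives the induction in `exists_refines_node`.
-/
theorem exists_graft_eq_graft (r x : BinaryTree Unit) :
    ∃ (f g : FreeForest Unit) (y : BinaryTree Unit), f.length = r.numLeaves ∧
      (g ++ [y]).length = x.numLeaves ∧ graft r f = graft x (g ++ [y]) ∧
      rightDepth y = rightDepth r - rightDepth x := by
  induction x generalizing r with
  | nil => exact ⟨_, [], r, List.length_replicate, rfl, graft_replicate r, rfl⟩
  | node u x₁ x₂ ih₁ ih₂ =>
    cases r with
    | nil =>
      have h := BinaryTree.numLeaves_pos (.node u x₁ x₂)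
      have e : List.replicate ((BinaryTree.node u x₁ x₂).numLeaves - 1) (.nil : BinaryTree Unit) ++
          [.nil] = List.replicate (BinaryTree.node u x₁ x₂).numLeaves .nil := by
        rw [← List.replicate_succ', Nat.sub_add_cancel h]
      refine ⟨[.node u x₁ x₂], List.replicate ((BinaryTree.node u x₁ x₂).numLeaves - 1) .nil, .nil,
        rfl, by rw [e, List.length_replicate], ?_, by simp [rightDepth]⟩
      rw [e, graft_replicate]
      rfl
    | node v r₁ r₂ =>
      obtain ⟨f₁, g₁, y₁, hf₁, hg₁, e₁, -⟩ := ih₁ r₁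
      obtain ⟨f₂, g₂, y₂, hf₂, hg₂, e₂, hy⟩ := ih₂ r₂
      refine ⟨f₁ ++ f₂, g₁ ++ [y₁] ++ g₂, y₂, by simp [hf₁, hf₂], ?_, ?_, ?_⟩
      · rw [List.append_assoc, List.length_append, hg₁, hg₂, BinaryTree.numLeaves]
      · rw [List.append_assoc, graft_node_append _ _ _ _ _ hf₁, graft_node_append _ _ _ _ _ hg₁,
          e₁, e₂]
      · rw [hy, rightDepth, rightDepth]
        omega

theorem colourBy_node {S : Type u} (c : S) (v : Unit) (l r : BinaryTree Unit) :
    colourBy c (.node v l r) = .node c (colourBy c l) (colourBy c r) := rfl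

theorem colourBy_graft {S : Type u} (c : S) (t : BinaryTree Unit) (g : FreeForest Unit)
    (hg : g.length = t.numLeaves) :
    colourBy c (graft t g) = graft (colourBy c t) (g.map (colourBy c)) := by
  induction t generalizing g with
  | nil =>
    obtain ⟨s, rfl⟩ := List.length_eq_one_iff.1 hg
    rfl
  | node v l r ihl ihr =>
    simp only [BinaryTree.numLeaves] at hg
    rw [graft, colourBy_node, ihl _ (by simp; omega), ihr _ (by simp; omega), colourBy_node, graft,
      numLeaves_colourBy, List.map_take, List.map_drop]

/-- The trees of `ts` glued on the leaves of a right-vine, with `z` on the last leaf. -/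
def vine {S : Type u} (c : S) (ts : List (FreeTree S)) (z : FreeTree S) : FreeTree S :=
  ts.foldr (fun t s => .node c t s) z

theorem graft_rightVine {S : Type u} (c : S) (ts : List (FreeTree S)) (z : FreeTree S) :
    graft (colourBy c (rightVine ts.length)) (ts ++ [z]) = vine c ts z := by
  induction ts with
  | nil => rfl
  | cons t ts ih =>
    rw [List.length_cons, rightVine, colourBy_node, List.cons_append, ← List.singleton_append,
      graft_node_append _ _ _ _ _ rfl, ih]
    rfl

/-- `s` is obtained from `t` by gluing trees on the leaves, up to the skein relations. -/
def Refines (P : SkeinPresentation.{u}) (t s : FreeTree P.Colour) : Prop :=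
  ∃ f : FreeForest P.Colour, f.length = t.numLeaves ∧ SkeinEq P [graft t f] [s]

namespace Refines

variable {P : SkeinPresentation.{u}} {t s w l l' r r' : FreeTree P.Colour}

theorem of_skeinEq (h : SkeinEq P [t] [s]) : Refines P t s :=
  ⟨_, List.length_replicate, (graft_replicate t).symm ▸ h⟩

theorem refl (t : FreeTree P.Colour) : Refines P t t := of_skeinEq (.refl _)

theorem nil (t : FreeTree P.Colour) : Refines P .nil t := ⟨[t], rfl, .refl _⟩

theorem trans (h : Refines P t s) (h' : Refines P s w) : Refines P t w := by
  obtain ⟨f, hf, e⟩ := h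
  obtain ⟨g, hg, e'⟩ := h'
  have hn : s.numLeaves = leaves f := by
    have := e.leaves_length.1
    simp only [leaves_cons, leaves_nil, add_zero, numLeaves_graft _ _ hf] at this
    exact this.symm
  refine ⟨stack f g, by simpa using hf, ?_⟩
  rw [← graft_graft _ _ _ hf (hg.trans hn)]
  have := SkeinEq.stack _ _ g g (by simpa [numLeaves_graft _ _ hf] using hg.trans hn)
    (by simpa using hg) e (.refl g)
  rw [stack_singleton _ _ (by rw [numLeaves_graft _ _ hf, hg, hn]), stack_singleton _ _ hg] at this
  exact this.trans _ _ _ e'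

theorem node (c : P.Colour) (hl : Refines P l l') (hr : Refines P r r') :
    Refines P (.node c l r) (.node c l' r') := by
  obtain ⟨f, hf, e⟩ := hl
  obtain ⟨g, hg, e'⟩ := hr
  refine ⟨f ++ g, by simp [hf, hg], ?_⟩
  rw [graft_node_append _ _ _ _ _ hf]
  exact SkeinEq.stack [.node c .nil .nil] [.node c .nil .nil] ([_] ++ [_]) ([_] ++ [_]) rfl rfl
    (.refl _) (.append _ _ _ _ e e')

theorem vine (c : P.Colour) (ts : List (FreeTree P.Colour)) (h : Refines P t s) :
    Refines P (vine c ts t) (vine c ts s) := by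
  induction ts with
  | nil => exact h
  | cons u ts ih => exact .node c (.refl u) ih

end Refines

/-! ### Cofinality of the trees of colour `a` -/

section Vine

variable {P : SkeinPresentation.{u}} {x : BinaryTree Unit} {a b : P.Colour}
  (hrel : SkeinEq P [colourBy a x] [colourBy b (rightVine x.numNodes)])
include hrel

theorem skeinEq_vine (ts : List (BinaryTree Unit)) (z : BinaryTree Unit)
    (hts : ts.length = x.numNodes) :
    SkeinEq P [colourBy a (graft x (ts ++ [z]))]
      [vine b (ts.map (colourBy a)) (colourBy a z)] := by
  have hx := x.numLeaves_eq_numNodes_succ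
  have hl : (ts ++ [z]).length = x.numLeaves := by simp [hts, hx]
  have hl' : ((ts ++ [z]).map (colourBy a)).length = x.numLeaves := by simpa using hl
  have h := SkeinEq.stack [colourBy a x]
    [colourBy b (rightVine x.numNodes)] _ _
    (by simpa [numLeaves_colourBy] using hl')
    (by simpa [numLeaves_colourBy, numLeaves_rightVine, hx] using hl')
    hrel (.refl ((ts ++ [z]).map (colourBy a)))
  rw [stack_singleton _ _ (by rw [numLeaves_colourBy, hl']),
    stack_singleton _ _ (by rw [numLeaves_colourBy, numLeaves_rightVine, hl', hx]),
    ← colourBy_graft _ _ _ hl, List.map_append, ← hts] at h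
  have e := graft_rightVine b (ts.map (colourBy a)) (colourBy a z)
  rw [List.length_map] at e
  rwa [← e]

/-- A root caret of colour `b` is removed by completing it to a full `b`-vine, which the skein
relation turns into `x(a)`. When `r` is trivial, a vine can be glued on it. Otherwise `r` is refined
to begin with `x(a)`, which is rewritten as a `b`-vine. Together with the root caret this is one
caret too many, and the last caret carries a tree of smaller right depth, so induction absorbs it.
-/
theorem exists_refines_node (hx : 2 ≤ x.numLeaves) (l r : BinaryTree Unit) :
    ∃ w, Refines P
      (.node b (colourBy a l) (colourBy a r))
      (colourBy a w) := by
  have hn := x.numLeaves_eq_numNodes_succ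
  induction hd : rightDepth r using Nat.strong_induction_on generalizing l r with
  | _ d ih =>
    cases r with
    | nil =>
      -- The root caret is the first of `x.numNodes` carets, so the vine glued on the right leaf has
      -- one caret fewer.
      refine ⟨graft x (l :: List.replicate (x.numNodes - 1) .nil ++ [.nil]), ?_⟩
      refine .trans (.node _ (.refl _) (.nil
        (vine b ((List.replicate (x.numNodes - 1) .nil).map (colourBy a))
          (colourBy a .nil)))) (.of_skeinEq (.symm _ _ (skeinEq_vine hrel _ _ ?_)))
      simp only [List.length_cons, List.length_replicate]
      omega
    | node v r₁ r₂ =>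
      obtain ⟨f, g, y, hf, hg, e, hy⟩ := exists_graft_eq_graft (.node v r₁ r₂) x
      have hxd : 0 < rightDepth x := by
        cases x with
        | nil => simp at hx
        | node => exact Nat.succ_pos _
      have hlt : rightDepth y < d := by
        rw [hy, ← hd]
        exact Nat.sub_lt (Nat.succ_pos _) hxd
      have hgl : g.length = x.numNodes := by
        rw [List.length_append, List.length_singleton] at hg
        omega
      -- Splitting off `z` isolates the last caret of the vine, `.node b z y`, to which the
      -- induction hypothesis applies.
      obtain ⟨g, z, rfl⟩ : ∃ g' z, g = g' ++ [z] :=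
        ⟨_, _, (List.dropLast_append_getLast (List.ne_nil_of_length_pos (by omega))).symm⟩
      obtain ⟨w, hw⟩ := ih _ hlt z y rfl
      refine ⟨graft x (l :: g ++ [w]), ?_⟩
      have h₁ : Refines P (colourBy a (.node v r₁ r₂))
          (colourBy a (graft x (g ++ [z] ++ [y]))) := by
        refine ⟨f.map (colourBy a), by simpa [numLeaves_colourBy] using hf, ?_⟩
        rw [← e, colourBy_graft _ _ _ hf]
        exact .refl _
      have h₂ := h₁.trans (.of_skeinEq (skeinEq_vine hrel _ _ hgl))
      have h₃ := Refines.vine b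
        (colourBy a l :: g.map (colourBy a)) hw
      have h₄ := Refines.of_skeinEq (SkeinEq.symm _ _ (skeinEq_vine hrel (l :: g) w (by
        rw [List.length_append, List.length_singleton] at hgl
        exact hgl)))
      refine (Refines.node _ (.refl _) h₂).trans (Refines.trans ?_ (h₃.trans h₄))
      simp only [vine, List.map_append, List.foldr_append, List.foldr_cons]
      exact .refl _

theorem exists_refines_colourBy (hx : 2 ≤ x.numLeaves)
    (hab : ∀ c, c = a ∨ c = b) (t : FreeTree P.Colour) :
    ∃ w, Refines P t (colourBy a w) := by
  induction t with
  | nil => exact ⟨.nil, .refl _⟩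
  | node c l r ihl ihr =>
    obtain ⟨l', hl⟩ := ihl
    obtain ⟨r', hr⟩ := ihr
    obtain rfl | rfl := hab c
    · exact ⟨.node () l' r', .node _ hl hr⟩
    · obtain ⟨w, hw⟩ := exists_refines_node hrel hx l' r'
      exact ⟨w, (Refines.node _ hl hr).trans hw⟩

/-- After refinement both trees have colour `a` only, where superposition is available. -/
theorem exists_common_refinement (hx : 2 ≤ x.numLeaves)
    (hab : ∀ c, c = a ∨ c = b) (t s : FreeTree P.Colour) :
    ∃ w, Refines P t w ∧ Refines P s w := by
  obtain ⟨t', ht⟩ := exists_refines_colourBy hrel hx hab t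
  obtain ⟨s', hs⟩ := exists_refines_colourBy hrel hx hab s
  obtain ⟨f, g, y, hf, hg, e, -⟩ := exists_graft_eq_graft t' s'
  refine ⟨colourBy a (graft t' f), ht.trans ⟨f.map (colourBy a), ?_, ?_⟩,
    hs.trans ⟨(g ++ [y]).map (colourBy a), ?_, ?_⟩⟩
  · rw [List.length_map, numLeaves_colourBy, hf]
  · rw [colourBy_graft _ _ _ hf]
    exact .refl _
  · rw [List.length_map, numLeaves_colourBy, hg]
  · rw [e, colourBy_graft _ _ _ hg]
    exact .refl _

theorem exists_stack_skeinEq_stack (hx : 2 ≤ x.numLeaves)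
    (hab : ∀ c, c = a ∨ c = b) (f g : FreeForest P.Colour)
    (hfg : f.length = g.length) : ∃ p q : FreeForest P.Colour, p.length = leaves f ∧
      q.length = leaves g ∧ SkeinEq P (stack f p) (stack g q) := by
  induction f generalizing g with
  | nil =>
    obtain rfl := List.length_eq_zero_iff.1 hfg.symm
    exact ⟨[], [], rfl, rfl, .refl _⟩
  | cons t f ih =>
    cases g with
    | nil => simp at hfg
    | cons s g =>
      obtain ⟨p, q, hp, hq, h⟩ := ih g (by simpa using hfg)
      obtain ⟨w, ⟨p', hp', ht⟩, q', hq', hs⟩ := exists_common_refinement hrel hx hab t s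
      refine ⟨p' ++ p, q' ++ q, by simp [hp, hp'], by simp [hq, hq'], ?_⟩
      simp only [stack]
      rw [List.take_left' hp', List.drop_left' hp', List.take_left' hq', List.drop_left' hq']
      exact .append [_] [_] _ _ (ht.trans _ _ _ (.symm _ _ hs)) h

end Vine

/-! ### The forest-skein category acting on the line -/

section LineFunctor

variable {P : SkeinPresentation.{u}} {h : P.Colour → (ℝ ≃o ℝ)}
  (hh : ∀ c, TranslatesOutside (h c) 2 1) (hrel : ∀ s t, P.Rel s t → treeMap h s = treeMap h t)

/-- The functor sending a forest to the transformation of the line that it gives. -/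
def lineFunctor : FSCat P ⥤ SingleObj (ℝ ≃o ℝ) where
  obj _ := SingleObj.star _
  map {X Y} p := Quotient.lift (fun f : FreeHom P X.size Y.size => forestMap h f.forest)
    (fun _ _ e => forestMap_eq_of_skeinEq hh hrel e) p
  map_id X := forestMap_replicate h X.size
  map_comp {X Y Z} p q := by
    induction p using Quotient.inductionOn with
    | h g =>
      induction q using Quotient.inductionOn with
      | h f => exact forestMap_stack hh _ _ (g.length_eq.trans f.leaves_eq.symm)

theorem translatesOutside_lineFunctor_map {X Y : FSCat P} (p : X ⟶ Y) :
    TranslatesOutside ((lineFunctor hh hrel).map p) X.size Y.size := by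
  induction p using Quotient.inductionOn with
  | h f =>
    have := translatesOutside_forestMap hh f.forest
    rwa [f.leaves_eq, f.length_eq] at this

theorem lineFunctor_map_mem (N : Subgroup (ℝ ≃o ℝ)) (hN : ∀ c, h c ∈ N)
    (hT : ∀ n : ℕ, translate n ∈ N) {X Y : FSCat P} (p : X ⟶ Y) :
    ((lineFunctor hh hrel).map p : ℝ ≃o ℝ) ∈ N := by
  induction p using Quotient.inductionOn with
  | h f => exact forestMap_mem h N hN hT f.forest

end LineFunctor

/-- The presentation in which all trees with equal actions on the line are identified. -/
def actionPresentation {S : Type u} (h : S → (ℝ ≃o ℝ)) : SkeinPresentation.{u} where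
  Colour := S
  Rel s t := s.numLeaves = t.numLeaves ∧ treeMap h s = treeMap h t
  numLeaves_eq _ _ e := e.1

/-! ### The quotient by equality of actions -/

section Faithful

variable {S : Type u} {h : S → (ℝ ≃o ℝ)} (hh : ∀ c, TranslatesOutside (h c) 2 1)
include hh

/-- The number of roots has to be given: it cannot be seen from the action, since all trivial
forests act as the identity. The trees are then compared one by one with `forestMap_cons_inj`. -/
theorem skeinEq_of_forestMap_eq {f g : FreeForest S} (hl : f.length = g.length)
    (e : forestMap h f = forestMap h g) : SkeinEq (actionPresentation h) f g := by
  induction f generalizing g with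
  | nil =>
    obtain rfl := List.length_eq_zero_iff.1 hl.symm
    exact .refl _
  | cons t f ih =>
    cases g with
    | nil => simp at hl
    | cons s g =>
      obtain ⟨h₁, h₂, h₃⟩ := forestMap_cons_inj hh e
      exact .append (P := actionPresentation h) [t] [s] f g
        (.rel (P := actionPresentation h) t s ⟨h₁, h₂⟩) (ih (by simpa using hl) h₃)

theorem forestMap_eq_of_skeinEq_action {f g : FreeForest S}
    (e : SkeinEq (actionPresentation h) f g) : forestMap h f = forestMap h g :=
  forestMap_eq_of_skeinEq (P := actionPresentation h) hh (fun _ _ e => e.2) e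

/-- Forests act by elements of a group, and in this category they are determined by their action. -/
theorem leftCancellative_actionPresentation : LeftCancellative (actionPresentation h) := by
  intro X Y Z f p q e
  induction f using Quotient.inductionOn with
  | h f =>
  induction p using Quotient.inductionOn with
  | h p =>
  induction q using Quotient.inductionOn with
  | h q =>
  have e' := forestMap_eq_of_skeinEq_action hh (Quotient.exact e)
  have hp : p.forest.length = leaves f.forest := p.length_eq.trans f.leaves_eq.symm
  have hq : q.forest.length = leaves f.forest := q.length_eq.trans f.leaves_eq.symm
  refine Quotient.sound (skeinEq_of_forestMap_eq hh (hp.trans hq.symm) ?_)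
  exact mul_left_cancel
    ((forestMap_stack hh _ _ hp).symm.trans (e'.trans (forestMap_stack hh _ _ hq)))

end Faithful

section Quotient

variable {P : SkeinPresentation.{u}} {h : P.Colour → (ℝ ≃o ℝ)}
  (hh : ∀ c, TranslatesOutside (h c) 2 1) (hrel : ∀ s t, P.Rel s t → treeMap h s = treeMap h t)

/-- The quotient map to the category of transformations given by forests. -/
def toActionPresentation : FSMorphism P (actionPresentation h) where
  map {l r} p := Quotient.map
    (fun f : FreeHom P l r =>
      (⟨f.forest, f.leaves_eq, f.length_eq⟩ : FreeHom (actionPresentation h) l r))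
    (fun f g e => skeinEq_of_forestMap_eq hh (f.length_eq.trans g.length_eq.symm)
      (forestMap_eq_of_skeinEq hh hrel e)) p
  map_id _ := rfl
  map_comp p q := by
    induction p using Quotient.inductionOn with
    | h p => induction q using Quotient.inductionOn with
      | h q => rfl
  map_tensor p q := by
    induction p using Quotient.inductionOn with
    | h p => induction q using Quotient.inductionOn with
      | h q => rfl

/-- Simplicity makes the quotient by equality of actions an isomorphism, so forests with the same
action were already equal. -/
theorem IsSimpleFS.faithful_lineFunctor (hP : IsSimpleFS P) :
    (lineFunctor hh hrel).Faithful where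
  map_injective {X Y p q} e := by
    refine hP _ (toActionPresentation hh hrel) (fun l r p => ?_)
      (leftCancellative_actionPresentation hh) X.size Y.size ?_
    · induction p using Quotient.inductionOn with
      | h f => exact ⟨Quotient.mk _ ⟨f.forest, f.leaves_eq, f.length_eq⟩, rfl⟩
    · induction p using Quotient.inductionOn with
      | h f =>
      induction q using Quotient.inductionOn with
      | h g =>
      exact Quotient.sound (skeinEq_of_forestMap_eq hh (f.length_eq.trans g.length_eq.symm) e)

end Quotient

/-! ### The fraction group acting on the line -/

section Fractions

variable {C : Type*} [Category* C] {Γ : Type*} [Group Γ] (F : C ⥤ SingleObj Γ)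

/-- A functor to a group extends to the isotropy groups of the enveloping groupoid. -/
noncomputable def isotropyMap (X : C) : Aut ((⊤ : MorphismProperty C).Q.obj X) →* Γ where
  toFun g := (Localization.Construction.lift F (W := ⊤) fun _ _ _ _ => inferInstance).map g.hom
  map_one' := CategoryTheory.Functor.map_id _ _
  map_mul' f g := Functor.map_comp _ g.hom f.hom

variable [(⊤ : MorphismProperty C).HasRightCalculusOfFractions]

theorem exists_fraction {X : C} (g : Aut ((⊤ : MorphismProperty C).Q.obj X)) :
    ∃ (Y : C) (s t : Y ⟶ X), (⊤ : MorphismProperty C).Q.map s ≫ g.hom =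
      (⊤ : MorphismProperty C).Q.map t := by
  obtain ⟨φ, hφ⟩ := Localization.exists_rightFraction (⊤ : MorphismProperty C).Q ⊤ g.hom
  exact ⟨_, φ.s, φ.f, by rw [hφ, MorphismProperty.RightFraction.map_s_comp_map]⟩

omit [(⊤ : MorphismProperty C).HasRightCalculusOfFractions] in
theorem isotropyMap_mul {X Y : C} {g : Aut ((⊤ : MorphismProperty C).Q.obj X)} {s t : Y ⟶ X}
    (e : (⊤ : MorphismProperty C).Q.map s ≫ g.hom = (⊤ : MorphismProperty C).Q.map t) :
    isotropyMap F X g * (F.map s : Γ) = F.map t := by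
  have := congrArg (Localization.Construction.lift F (W := ⊤) fun _ _ _ _ => inferInstance).map e
  rw [Functor.map_comp] at this
  have hQ : ∀ s : Y ⟶ X, (Localization.Construction.lift F (W := ⊤) fun _ _ _ _ =>
      inferInstance).map ((⊤ : MorphismProperty C).Q.map s) = F.map s := fun s => by
    simpa using Functor.congr_hom (Localization.Construction.fac F (W := ⊤) fun _ _ _ _ =>
      inferInstance) s
  rw [hQ, hQ] at this
  exact this

/-- If a fraction `t ∘ s⁻¹` acts trivially, then `s` and `t` act alike, so they are equal by
faithfulness and the fraction is the identity. -/
theorem injective_isotropyMap [F.Faithful] (X : C) : Function.Injective (isotropyMap F X) := by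
  rw [injective_iff_map_eq_one]
  intro g hg
  obtain ⟨Y, s, t, e⟩ := exists_fraction g
  have h := isotropyMap_mul F e
  rw [hg, one_mul] at h
  obtain rfl := F.map_injective h
  have : IsIso ((⊤ : MorphismProperty C).Q.map s) := MorphismProperty.Q_inverts _ _ trivial
  refine Iso.ext ?_
  rw [← cancel_epi ((⊤ : MorphismProperty C).Q.map s), e]
  exact (Category.comp_id _).symm

end Fractions

/-! ### Embedding of the forest-skein group in `𝓘F` -/

section VineGroup

variable {x : BinaryTree Unit} (hx : 2 ≤ x.numLeaves)

/-- The action on the line of the category `⟨a, b | x(a) = ρ(b)⟩`. -/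
noncomputable def vineFunctor : FSCat (vinePresentation x) ⥤ SingleObj (ℝ ≃o ℝ) :=
  lineFunctor (P := vinePresentation x) (h := caretMap hx) (translatesOutside_caretMap hx) (by
    rintro _ _ ⟨rfl, rfl⟩
    exact treeMap_caretMap_eq hx)

theorem faithful_vineFunctor (hsimple : IsSimpleFS (vinePresentation x)) :
    (vineFunctor hx).Faithful := hsimple.faithful_lineFunctor _ _

include hx in
-- Common multiples come from the cofinality of the trees of colour `a`; the cancellation axiom
-- comes from the faithful action, which is where simplicity enters.
theorem hasRightCalculusOfFractions_vine (hsimple : IsSimpleFS (vinePresentation x)) :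
    (⊤ : MorphismProperty (FSCat (vinePresentation x))).HasRightCalculusOfFractions where
  exists_rightFraction X Y φ := by
    obtain ⟨f, s, -⟩ := φ
    obtain ⟨f, rfl⟩ := Quotient.exists_rep f
    obtain ⟨s, rfl⟩ := Quotient.exists_rep s
    obtain ⟨p, q, hp, hq, e⟩ := exists_stack_skeinEq_stack (P := vinePresentation x)
      (a := TwoColours.a) (b := TwoColours.b) (.rel _ _ ⟨rfl, rfl⟩) hx
      (by rintro (_ | _); exacts [.inl rfl, .inr rfl]) f.forest s.forest
      (f.length_eq.trans s.length_eq.symm)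
    have hl : leaves q = leaves p := by
      have := e.leaves_length.1
      rw [leaves_stack _ _ hp, leaves_stack _ _ hq] at this
      exact this.symm
    refine ⟨⟨(Quotient.mk _ ⟨p, rfl, hp.trans f.leaves_eq⟩ : (⟨leaves p⟩ : FSCat _) ⟶ X), trivial,
      Quotient.mk _ ⟨q, hl, hq.trans s.leaves_eq⟩⟩, Quotient.sound e⟩
  ext X Y Z p q f _ e := by
    have := faithful_vineFunctor hx hsimple
    refine ⟨X, 𝟙 X, trivial, congrArg _ ((vineFunctor hx).map_injective ?_)⟩
    have h := congrArg (vineFunctor hx).map e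
    rw [Functor.map_comp, Functor.map_comp] at h
    exact (cancel_mono _).1 h

include hx in
theorem exists_injective_hom_infinitePLGroup (hsimple : IsSimpleFS (vinePresentation x)) :
    ∃ γ : FSGroup (vinePresentation x) →* InfinitePLGroup, Function.Injective γ := by
  have := faithful_vineFunctor hx hsimple
  have := hasRightCalculusOfFractions_vine hx hsimple
  have hmem : ∀ g : FSGroup (vinePresentation x),
      isotropyMap (vineFunctor hx) ⟨1⟩ g ∈ unitSupported ⊓ rightPL := by
    intro g
    obtain ⟨Y, s, t, e⟩ := exists_fraction g
    have ht : ∀ t : Y ⟶ ⟨1⟩, TranslatesOutside ((vineFunctor hx).map t) Y.size 1 :=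
      fun t => translatesOutside_lineFunctor_map _ _ t
    have hm : ∀ t : Y ⟶ ⟨1⟩, ((vineFunctor hx).map t : ℝ ≃o ℝ) ∈ rightPL := fun t =>
      lineFunctor_map_mem _ _ rightPL (caretMap_mem_rightPL hx)
        (fun n => finitePL_le_rightPL (by simpa using translate_mem_finitePL n)) t
    rw [eq_mul_inv_of_mul_eq (isotropyMap_mul (vineFunctor hx) e)]
    exact ⟨(ht t).mul (ht s).inv, rightPL.mul_mem (hm t) (rightPL.inv_mem (hm s))⟩
  refine ⟨periodize.comp ((isotropyMap (vineFunctor hx) ⟨1⟩).codRestrict _ hmem),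
    injective_periodize.comp fun f g e => injective_isotropyMap (vineFunctor hx) _ ?_⟩
  exact congrArg Subtype.val e

end VineGroup

/-! ### Bi-orderability -/

/-- Two distinct transformations have a first point at which they separate, and they separate there
with different slopes. -/
theorem IsInfinitePL.exists_first_difference {f g : ℝ ≃o ℝ} (hf : IsInfinitePL f)
    (hg : IsInfinitePL g) (hne : f ≠ g) :
    ∃ p : ℝ, 0 ≤ p ∧ (∀ y ∈ Set.Icc 0 p, f y = g y) ∧ ∃ (k j : ℤ) (q : ℝ), k ≠ j ∧ p < q ∧
      ∀ y ∈ Set.Ico p q, f y = f p + 2 ^ k * (y - p) ∧ g y = f p + 2 ^ j * (y - p) := by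
  have hnat : ∀ {f : ℝ ≃o ℝ}, IsInfinitePL f → ∀ (n : ℕ) x, f (x + n) = f x + n := by
    intro f hf n x
    induction n with
    | zero => simp
    | succ n ih => rw [Nat.cast_succ, ← add_assoc, hf.map_add_one, ih, add_assoc]
  set S : Set ℝ := {x | 0 ≤ x ∧ f x ≠ g x} with hS
  have hSne : S.Nonempty := by
    obtain ⟨x, hx⟩ : ∃ x, f x ≠ g x := by
      by_contra! h
      exact hne (RelIso.ext h)
    obtain ⟨n, hn⟩ := exists_nat_ge (-x)
    -- By periodicity a difference at a negative point recurs at a non-negative one.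
    refine ⟨x + n, by linarith, fun e => hx ?_⟩
    rw [hnat hf, hnat hg] at e
    exact add_right_cancel e
  have hbdd : BddBelow S := ⟨0, fun x hx => hx.1⟩
  have hp : 0 ≤ sInf S := le_csInf hSne fun x hx => hx.1
  have hlt : ∀ y, 0 ≤ y → y < sInf S → f y = g y := fun y hy hy' => by
    by_contra h
    exact (csInf_le hbdd ⟨hy, h⟩).not_gt hy'
  generalize hpdef : sInf S = p at hp hlt
  have hpp : f p = g p := by
    rcases hp.eq_or_lt with rfl | hp
    · rw [hf.map_zero, hg.map_zero]
    · have hcl : IsClosed {y | f y = g y} := isClosed_eq f.continuous g.continuous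
      have hsub : Set.Ioo 0 p ⊆ {y | f y = g y} := fun y hy => hlt y hy.1.le hy.2
      have := hcl.closure_subset_iff.2 hsub
      rw [closure_Ioo hp.ne] at this
      exact this ⟨hp.le, le_rfl⟩
  obtain ⟨k, q, hq, hfk⟩ := hf.rightAffine p
  obtain ⟨j, r, hr, hgj⟩ := hg.rightAffine p
  refine ⟨p, hp, fun y hy => ?_, k, j, min q r, fun hkj => ?_, lt_min hq hr, fun y hy =>
    ⟨hfk y ⟨hy.1, hy.2.trans_le (min_le_left _ _)⟩,
      hpp ▸ hgj y ⟨hy.1, hy.2.trans_le (min_le_right _ _)⟩⟩⟩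
  · rcases hy.2.eq_or_lt with rfl | h
    · exact hpp
    · exact hlt y hy.1 h
  -- Equal slopes would make `f` and `g` agree up to `min q r`, beyond the infimum of the points
  -- where they differ.
  · have : min q r ≤ sInf S := by
      refine le_csInf hSne fun x hx => ?_
      by_contra! h
      refine hx.2 ?_
      rcases lt_or_ge x p with hxp | hxp
      · exact hlt x hx.1 hxp
      · rw [hfk x ⟨hxp, h.trans_le (min_le_left _ _)⟩,
          hgj x ⟨hxp, h.trans_le (min_le_right _ _)⟩, hkj, hpp]
    rw [hpdef] at this
    exact (lt_min hq hr).not_ge this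

/-- `g` exceeds `f` to the right of the first point at which they separate. -/
def LexLT (f g : ℝ ≃o ℝ) : Prop :=
  ∃ p q : ℝ, 0 ≤ p ∧ p < q ∧ (∀ y ∈ Set.Icc 0 p, f y = g y) ∧ ∀ y ∈ Set.Ioo p q, f y < g y

namespace LexLT

variable {f g h : ℝ ≃o ℝ}

theorem irrefl (f : ℝ ≃o ℝ) : ¬ LexLT f f := by
  rintro ⟨p, q, -, hpq, -, h⟩
  obtain ⟨y, hy⟩ := Set.nonempty_Ioo.2 hpq
  exact (h y hy).false

theorem trans (hfg : LexLT f g) (hgh : LexLT g h) : LexLT f h := by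
  obtain ⟨p, q, hp, hpq, e, l⟩ := hfg
  obtain ⟨p', q', hp', hpq', e', l'⟩ := hgh
  rcases lt_trichotomy p p' with hlt | rfl | hlt
  · refine ⟨p, min q p', hp, lt_min hpq hlt, fun y hy => (e y hy).trans
      (e' y ⟨hy.1, hy.2.trans hlt.le⟩), fun y hy => ?_⟩
    rw [← e' y ⟨hp.trans hy.1.le, hy.2.le.trans (min_le_right _ _)⟩]
    exact l y ⟨hy.1, hy.2.trans_le (min_le_left _ _)⟩
  · exact ⟨p, min q q', hp, lt_min hpq hpq', fun y hy => (e y hy).trans (e' y hy), fun y hy =>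
      (l y ⟨hy.1, hy.2.trans_le (min_le_left _ _)⟩).trans
        (l' y ⟨hy.1, hy.2.trans_le (min_le_right _ _)⟩)⟩
  · refine ⟨p', min q' p, hp', lt_min hpq' hlt, fun y hy =>
      (e y ⟨hy.1, hy.2.trans hlt.le⟩).trans (e' y hy), fun y hy => ?_⟩
    rw [e y ⟨hp'.trans hy.1.le, hy.2.le.trans (min_le_right _ _)⟩]
    exact l' y ⟨hy.1, hy.2.trans_le (min_le_left _ _)⟩

theorem mul_left (hfg : LexLT f g) (c : ℝ ≃o ℝ) : LexLT (c * f) (c * g) := by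
  obtain ⟨p, q, hp, hpq, e, l⟩ := hfg
  exact ⟨p, q, hp, hpq, fun y hy => congrArg c (e y hy), fun y hy => c.strictMono (l y hy)⟩

/-- Precomposition with `c` moves the point of separation to `c.symm p`; since `c` fixes `0`, it
carries the initial interval `[0, c.symm p]` onto `[0, p]`. -/
theorem mul_right (hfg : LexLT f g) {c : ℝ ≃o ℝ} (hc : c 0 = 0) : LexLT (f * c) (g * c) := by
  obtain ⟨p, q, hp, hpq, e, l⟩ := hfg
  refine ⟨c.symm p, c.symm q, ?_, c.symm.strictMono hpq, fun y hy => e (c y) ⟨?_, ?_⟩,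
    fun y hy => l (c y) ⟨?_, ?_⟩⟩
  · rwa [c.le_symm_apply, hc]
  · rw [← hc]
    exact c.monotone hy.1
  · exact c.le_symm_apply.1 hy.2
  · exact c.symm_apply_lt.1 hy.1
  · exact c.lt_symm_apply.1 hy.2

end LexLT

theorem IsInfinitePL.lexLT_or_lexLT {f g : ℝ ≃o ℝ} (hf : IsInfinitePL f) (hg : IsInfinitePL g)
    (hne : f ≠ g) : LexLT f g ∨ LexLT g f := by
  obtain ⟨p, hp, e, k, j, q, hkj, hpq, h⟩ := hf.exists_first_difference hg hne
  rcases lt_or_gt_of_ne hkj with hlt | hlt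
  · refine Or.inl ⟨p, q, hp, hpq, e, fun y hy => ?_⟩
    obtain ⟨h1, h2⟩ := h y ⟨hy.1.le, hy.2⟩
    rw [h1, h2]
    have := mul_lt_mul_of_pos_right (zpow_lt_zpow_right₀ (one_lt_two (α := ℝ)) hlt)
      (sub_pos.2 hy.1)
    linarith
  · refine Or.inr ⟨p, q, hp, hpq, fun y hy => (e y hy).symm, fun y hy => ?_⟩
    obtain ⟨h1, h2⟩ := h y ⟨hy.1.le, hy.2⟩
    rw [h1, h2]
    have := mul_lt_mul_of_pos_right (zpow_lt_zpow_right₀ (one_lt_two (α := ℝ)) hlt)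
      (sub_pos.2 hy.1)
    linarith

theorem biOrderable_of_rel {Γ : Type u} [Group Γ] (r : Γ → Γ → Prop) (irrefl : ∀ a, ¬ r a a)
    (trans : ∀ a b c, r a b → r b c → r a c) (total : ∀ a b, a ≠ b → r a b ∨ r b a)
    (mul_left : ∀ a b c, r a b → r (c * a) (c * b))
    (mul_right : ∀ a b c, r a b → r (a * c) (b * c)) : BiOrderable Γ := by
  classical
  have : IsStrictTotalOrder Γ r :=
    { trichotomous := fun a b h h' => by
        by_contra hne
        exact (total a b hne).elim h h'
      irrefl := irrefl
      trans := trans }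
  refine ⟨linearOrderOfSTO r, fun a b c hab => ?_⟩
  rcases hab with rfl | hab
  · exact ⟨Or.inl rfl, Or.inl rfl⟩
  · exact ⟨Or.inr (mul_left _ _ _ hab), Or.inr (mul_right _ _ _ hab)⟩

theorem biOrderable_infinitePLGroup : BiOrderable InfinitePLGroup :=
  biOrderable_of_rel (fun f g => LexLT f.1 g.1) (fun f => LexLT.irrefl f.1)
    (fun _ _ _ => LexLT.trans)
    (fun f g h => IsInfinitePL.lexLT_or_lexLT f.2 g.2 fun e => h (Subtype.ext e))
    (fun _ _ c h => h.mul_left c.1) (fun _ _ c h => h.mul_right (IsInfinitePL.map_zero c.2))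

theorem BiOrderable.of_injective {Γ Δ : Type*} [Group Γ] [Group Δ] (hΔ : BiOrderable Δ)
    (γ : Γ →* Δ) (hγ : Function.Injective γ) : BiOrderable Γ := by
  obtain ⟨o, ho⟩ := hΔ
  refine ⟨LinearOrder.lift' γ hγ, fun a b c hab => ?_⟩
  have h := ho _ _ (γ c) (show γ a ≤ γ b from hab)
  rw [← map_mul, ← map_mul, ← map_mul, ← map_mul] at h
  exact h

/-! ### Property (T) -/

/-! ### Permutation representations on `ℓ²` -/

section Permutation

variable {X : Type u}

theorem memℓp_comp_perm (σ : Equiv.Perm X) (f : lp (fun _ : X => ℂ) 2) :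
    Memℓp (fun x => f (σ x)) 2 := by
  have h := (memℓp_gen_iff (p := 2) (by simp)).1 (lp.memℓp f)
  exact (memℓp_gen_iff (by simp)).2 (σ.summable_iff.2 h)

/-- The isometry of `ℓ²(X)` induced by a permutation of `X`. -/
noncomputable def permIsometry (σ : Equiv.Perm X) :
    lp (fun _ : X => ℂ) 2 ≃ₗᵢ[ℂ] lp (fun _ : X => ℂ) 2 where
  toFun f := ⟨fun x => f (σ⁻¹ x), memℓp_comp_perm σ⁻¹ f⟩
  invFun f := ⟨fun x => f (σ x), memℓp_comp_perm σ f⟩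
  map_add' _ _ := rfl
  map_smul' _ _ := rfl
  left_inv f := by
    ext x
    simp
  right_inv f := by
    ext x
    simp
  norm_map' f := by
    rw [lp.norm_eq_tsum_rpow (by simp), lp.norm_eq_tsum_rpow (by simp)]
    congr 1
    exact Equiv.tsum_eq σ⁻¹ fun x => ‖f x‖ ^ (2 : ENNReal).toReal

theorem permIsometry_apply (σ : Equiv.Perm X) (f : lp (fun _ : X => ℂ) 2) (x : X) :
    permIsometry σ f x = f (σ⁻¹ x) := rfl

/-- The permutation representation on `ℓ²(X)`. -/
noncomputable def permRep (Γ : Type*) [Group Γ] [MulAction Γ X] :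
    Γ →* (lp (fun _ : X => ℂ) 2 ≃ₗᵢ[ℂ] lp (fun _ : X => ℂ) 2) where
  toFun g := permIsometry (MulAction.toPermHom Γ X g)
  map_one' := by
    ext f x
    simp [permIsometry_apply]
  map_mul' g h := by
    ext f x
    simp [permIsometry_apply, mul_smul]

theorem permRep_apply {Γ : Type*} [Group Γ] [MulAction Γ X] (g : Γ)
    (f : lp (fun _ : X => ℂ) 2) (x : X) : permRep Γ g f x = f (g⁻¹ • x) := by
  simp [permRep, permIsometry_apply]

end Permutation

/-- The one-dimensional representation of the circle group. -/
noncomputable def circleRep : Circle →* (ℂ ≃ₗᵢ[ℂ] ℂ) where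
  toFun c :=
    { toFun := fun z => c * z
      invFun := fun z => (c⁻¹ : Circle) * z
      map_add' := mul_add _
      map_smul' := fun a z => by simp [mul_left_comm]
      left_inv := fun z => by simp
      right_inv := fun z => by simp
      norm_map' := fun z => (norm_mul _ _).trans (by rw [Circle.norm_coe, one_mul]) }
  map_one' := by
    ext z
    simp
  map_mul' c d := by
    ext z
    exact (congrArg (· * z) (Circle.coe_mul c d)).trans (mul_assoc _ _ _)

/-- `(K, ε)` is a Kazhdan pair of `Γ`. -/
def IsKazhdanPair {Γ : Type u} [Group Γ] (K : Finset Γ) (ε : ℝ) : Prop :=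
  0 < ε ∧ ∀ (H : Type u) [NormedAddCommGroup H] [InnerProductSpace ℂ H] [CompleteSpace H]
    (π : Γ →* (H ≃ₗᵢ[ℂ] H)),
    (∃ v : H, ‖v‖ = 1 ∧ ∀ g ∈ K, ‖π g v - v‖ < ε) → ∃ v : H, v ≠ 0 ∧ ∀ g, π g v = v

/-! ### Finite-index subgroups and characters -/

namespace IsKazhdanPair

/-- In `ℓ²(Γ ⧸ H)` the point mass at the base coset is fixed by `K`, so there is a non-zero
invariant vector. It is constant by transitivity, and a non-zero constant is square-summable only on
a finite set. -/
theorem finiteIndex {Γ : Type u} [Group Γ] {K : Finset Γ} {ε : ℝ} (hK : IsKazhdanPair K ε)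
    (H : Subgroup Γ) (hH : ∀ g ∈ K, g ∈ H) : H.index ≠ 0 := by
  classical
  obtain ⟨v, hv0, hv⟩ := hK.2 (lp (fun _ : Γ ⧸ H => ℂ) 2) (permRep Γ)
    ⟨lp.single 2 ((1 : Γ) : Γ ⧸ H) 1, by simp [lp.norm_single], fun g hg => by
      have : permRep Γ g (lp.single 2 ((1 : Γ) : Γ ⧸ H) (1 : ℂ)) =
          lp.single 2 ((1 : Γ) : Γ ⧸ H) 1 := by
        have hfix : g • ((1 : Γ) : Γ ⧸ H) = ((1 : Γ) : Γ ⧸ H) := by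
          rw [MulAction.Quotient.smul_coe, QuotientGroup.eq]
          simpa using H.inv_mem (hH g hg)
        ext y
        rw [permRep_apply, lp.single_apply, lp.single_apply]
        simp only [Pi.single_apply, inv_smul_eq_iff, hfix]
      rw [this, sub_self, norm_zero]
      exact hK.1⟩
  have hconst : ∀ y, v y = v ((1 : Γ) : Γ ⧸ H) := by
    intro y
    obtain ⟨g, rfl⟩ := QuotientGroup.mk_surjective y
    have h := congrArg (fun w : lp (fun _ : Γ ⧸ H => ℂ) 2 => w (g : Γ ⧸ H)) (hv g)
    dsimp only at h
    rw [permRep_apply, MulAction.Quotient.smul_coe, smul_eq_mul, inv_mul_cancel] at h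
    exact h.symm
  have hs := (memℓp_gen_iff (p := 2) (by simp)).1 (lp.memℓp v)
  simp only [hconst] at hs
  have hne : v ((1 : Γ) : Γ ⧸ H) ≠ 0 := fun h0 => hv0 (by
    ext y
    rw [hconst, h0]
    rfl)
  intro h0
  have : Infinite (Γ ⧸ H) := Subgroup.index_eq_zero_iff_infinite.1 h0
  simp [summable_const_iff, hne] at hs

/-- For small `θ` the unitary character `exp (iθχ)` is almost trivial on the finite set `K`, so the
Kazhdan pair forces it to be trivial. For small `θ > 0` this is impossible when `χ ≠ 1`. -/
theorem eq_one_of_hom {Γ : Type} [Group Γ] {K : Finset Γ} {ε : ℝ} (hK : IsKazhdanPair K ε)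
    (χ : Γ →* Multiplicative ℤ) : χ = 1 := by
  by_contra hne
  obtain ⟨g₀, hg₀⟩ : ∃ g, χ g ≠ 1 := by
    by_contra! h
    exact hne (MonoidHom.ext h)
  have hg₀' : ((χ g₀).toAdd : ℝ) ≠ 0 := by
    simpa using hg₀
  have hsmall : ∀ᶠ θ : ℝ in 𝓝[>] 0, ∀ g ∈ K,
      ‖((Circle.exp (θ * (χ g).toAdd) : ℂ) * 1 - 1)‖ < ε := by
    refine (eventually_all_finset K).2 fun g _ =>
      Filter.Eventually.filter_mono nhdsWithin_le_nhds ?_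
    have hc : Continuous fun θ : ℝ => ‖((Circle.exp (θ * (χ g).toAdd) : ℂ) * 1 - 1)‖ := by
      fun_prop
    refine hc.continuousAt.eventually_lt_const ?_
    simpa using hK.1
  -- Staying within one full turn ensures that the character takes a value other than `1` at `g₀`.
  have hlt : ∀ᶠ θ : ℝ in 𝓝[>] 0, |θ * (χ g₀).toAdd| < 2 * Real.pi := by
    refine Filter.Eventually.filter_mono nhdsWithin_le_nhds ?_
    have hc : Continuous fun θ : ℝ => |θ * (χ g₀).toAdd| := by fun_prop
    refine hc.continuousAt.eventually_lt_const ?_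
    simp [Real.pi_pos]
  obtain ⟨θ, ⟨hθ, hθ'⟩, hpos⟩ := ((hsmall.and hlt).and self_mem_nhdsWithin).exists
  let ψ : Γ →* Circle :=
    { toFun := fun g => Circle.exp (θ * (χ g).toAdd)
      map_one' := by simp
      map_mul' := fun g h => by
        rw [map_mul χ, toAdd_mul, Int.cast_add, mul_add, Circle.exp_add] }
  obtain ⟨v, hv0, hv⟩ := hK.2 ℂ (circleRep.comp ψ) ⟨1, norm_one, hθ⟩
  have h1 : (Circle.exp (θ * (χ g₀).toAdd) : ℂ) = 1 := mul_right_cancel₀ hv0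
    ((hv g₀).trans (one_mul v).symm)
  obtain ⟨n, hn⟩ := Circle.exp_eq_one.1 (Circle.ext h1)
  rw [hn, abs_mul, abs_of_pos (by positivity : 0 < 2 * Real.pi)] at hθ'
  have hn1 : |(n : ℝ)| < 1 := by
    by_contra! h
    nlinarith [Real.pi_pos]
  have hn0 : n = 0 := Int.abs_lt_one_iff.1 (by exact_mod_cast hn1)
  rw [hn0, Int.cast_zero, zero_mul] at hn
  exact mul_ne_zero (ne_of_gt hpos) hg₀' hn

end IsKazhdanPair

/-- An increasing map that moves a point up or down keeps moving it the same way under iteration, so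
it has no non-trivial periodic points. -/
theorem apply_eq_of_pow_apply_eq {e : ℝ ≃o ℝ} {n : ℕ} (hn : 0 < n) {y : ℝ} (h : (e ^ n) y = y) :
    e y = y := by
  have hit : ∀ m : ℕ, (e ^ m) y = e^[m] y := by
    intro m
    induction m with
    | zero => rfl
    | succ m ih => rw [pow_succ', RelIso.mul_apply, ih, Function.iterate_succ_apply']
  rw [hit] at h
  exact ((Function.Commute.id_right (f := e)).iterate_pos_eq_iff_map_eq e.monotone strictMono_id
    hn).1 (by simpa using h)

/-- A subgroup of finite index that contains all roots of its elements is the whole group. -/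
theorem eq_top_of_index_ne_zero {Γ : Type*} [Group Γ] {H : Subgroup Γ} (hH : H.index ≠ 0)
    (hroot : ∀ g n, 0 < n → g ^ n ∈ H → g ∈ H) : H = ⊤ := by
  refine eq_top_iff.2 fun g _ => ?_
  obtain ⟨n, hn, -, h⟩ := Subgroup.exists_pow_mem_of_index_ne_zero hH g
  exact hroot g n hn h

/-! ### Right germs at a common fixed point -/

section Germ

/-- The pointwise stabilizer of `[0, p]`. -/
def fixingUpTo (p : ℝ) : Subgroup (ℝ ≃o ℝ) where
  carrier := {f | ∀ y ∈ Set.Icc 0 p, f y = y}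
  one_mem' _ _ := rfl
  mul_mem' {f _} hf hg y hy := (congrArg f (hg y hy)).trans (hf y hy)
  inv_mem' {f} hf y hy := (OrderIso.symm_apply_eq f).2 (hf y hy).symm

theorem exists_slope {f : ℝ ≃o ℝ} (hf : IsInfinitePL f) {p : ℝ} (hp : f p = p) :
    ∃ k : ℤ, ∀ᶠ y in 𝓝[>] p, f y = p + 2 ^ k * (y - p) := by
  obtain ⟨k, q, hq, h⟩ := hf.rightAffine p
  refine ⟨k, ?_⟩
  filter_upwards [Ioo_mem_nhdsGT hq] with y hy
  rw [h y ⟨hy.1.le, hy.2⟩, hp]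

theorem slope_unique {f : ℝ → ℝ} {p : ℝ} {k j : ℤ}
    (hk : ∀ᶠ y in 𝓝[>] p, f y = p + 2 ^ k * (y - p))
    (hj : ∀ᶠ y in 𝓝[>] p, f y = p + 2 ^ j * (y - p)) : k = j := by
  obtain ⟨y, ⟨h1, h2⟩, hy⟩ := ((hk.and hj).and self_mem_nhdsWithin).exists
  rw [h1] at h2
  have := mul_right_cancel₀ (sub_pos.2 hy).ne' (add_left_cancel h2)
  exact zpow_right_injective₀ (by norm_num) (by norm_num) this

/-- The logarithm of the right slope at a fixed point `p`. -/
noncomputable def slopeHom {Γ : Type*} [Group Γ] (γ : Γ →* InfinitePLGroup) (p : ℝ)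
    (hp : ∀ g, (γ g).1 p = p) : Γ →* Multiplicative ℤ := by
  have hex : ∀ g, ∃ k : ℤ, ∀ᶠ y in 𝓝[>] p, (γ g).1 y = p + 2 ^ k * (y - p) := fun g =>
    exists_slope (γ g).2 (hp g)
  refine MonoidHom.mk' (fun g => Multiplicative.ofAdd (hex g).choose) fun g h => ?_
  refine congrArg Multiplicative.ofAdd (slope_unique (hex (g * h)).choose_spec ?_)
  have ht : Tendsto (γ h).1 (𝓝[>] p) (𝓝[>] p) := by
    conv => rhs; rw [← hp h]
    exact (γ h).1.continuous.continuousWithinAt.tendsto_nhdsWithin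
      fun _ hy => (γ h).1.strictMono hy
  filter_upwards [(hex h).choose_spec, ht.eventually (hex g).choose_spec] with y h1 h2
  rw [map_mul]
  change (γ g).1 ((γ h).1 y) = _
  rw [h2, h1, add_sub_cancel_left, zpow_add₀ (by norm_num), mul_assoc]
  rfl

theorem slopeHom_spec {Γ : Type*} [Group Γ] (γ : Γ →* InfinitePLGroup) (p : ℝ)
    (hp : ∀ g, (γ g).1 p = p) (g : Γ) :
    ∀ᶠ y in 𝓝[>] p, (γ g).1 y = p + 2 ^ (slopeHom γ p hp g).toAdd * (y - p) :=
  (exists_slope (γ g).2 (hp g)).choose_spec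

end Germ

/-- The set `K` of a Kazhdan pair stands in for a generating set: a root-closed subgroup containing
it has finite index and is therefore everything. Looking at the first point moved by `K` then yields
a forbidden homomorphism to `ℤ`. -/
theorem subsingleton_of_kazhdanPropertyT {Γ : Type} [Group Γ] (hT : KazhdanPropertyT Γ)
    (γ : Γ →* InfinitePLGroup) (hγ : Function.Injective γ) : Subsingleton Γ := by
  obtain ⟨K, ε, hK⟩ := hT
  replace hK : IsKazhdanPair K ε := hK
  have hpow : ∀ (g : Γ) (n : ℕ), (γ (g ^ n)).1 = (γ g).1 ^ n := fun g n => by simp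
  by_cases hK1 : ∀ g ∈ K, g = 1
  -- Here the trivial subgroup has finite index, and it is closed under roots because the group is
  -- torsion-free.
  · have htop : (⊥ : Subgroup Γ) = ⊤ := by
      refine eq_top_of_index_ne_zero (hK.finiteIndex ⊥ fun g hg => Subgroup.mem_bot.2 (hK1 g hg))
        fun _ n hn h => Subgroup.mem_bot.2 (hγ (Subtype.ext (RelIso.ext fun y => ?_)))
      rw [map_one]
      refine apply_eq_of_pow_apply_eq hn ?_
      rw [← hpow, Subgroup.mem_bot.1 h, map_one]
      rfl
    exact Subgroup.subsingleton_iff.1 (subsingleton_iff_bot_eq_top.1 htop)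
  push Not at hK1
  have hfirst : ∀ g : Γ, ∃ p : ℝ, g ≠ 1 → 0 ≤ p ∧ (γ g).1 ∈ fixingUpTo p ∧
      ∃ k : ℤ, k ≠ 0 ∧ ∀ᶠ y in 𝓝[>] p, (γ g).1 y = p + 2 ^ k * (y - p) := by
    intro g
    by_cases hg : g = 1
    · exact ⟨0, fun h => (h hg).elim⟩
    have hne : (γ g).1 ≠ 1 := fun e => hg (hγ (by rw [map_one]; exact Subtype.ext e))
    obtain ⟨p, hp, e, k, j, q, hkj, hpq, h⟩ :=
      IsInfinitePL.exists_first_difference (γ g).2 IsInfinitePL.one hne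
    have hpp : (γ g).1 p = p := e p ⟨hp, le_rfl⟩
    have hj : j = 0 := by
      refine slope_unique (f := fun y => y) (p := p) ?_ (by simp)
      filter_upwards [Ioo_mem_nhdsGT hpq] with y hy
      exact ((h y ⟨hy.1.le, hy.2⟩).2).trans (by rw [hpp])
    refine ⟨p, fun _ => ⟨hp, e, k, hj ▸ hkj, ?_⟩⟩
    filter_upwards [Ioo_mem_nhdsGT hpq] with y hy
    rw [(h y ⟨hy.1.le, hy.2⟩).1, hpp]
  choose p hp using hfirst
  classical
  obtain ⟨g₀, hg₀, hmin⟩ := (K.filter (· ≠ 1)).exists_min_image p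
    (by obtain ⟨g, hg, hg'⟩ := hK1; exact ⟨g, Finset.mem_filter.2 ⟨hg, hg'⟩⟩)
  obtain ⟨hp0, -, k, hk, hslope⟩ := hp g₀ (Finset.mem_filter.1 hg₀).2
  -- By minimality of `p g₀` every element of `K` fixes `[0, p g₀]` pointwise, and then so does the
  -- whole group.
  have htop : (fixingUpTo (p g₀)).comap (InfinitePLGroup.subtype.comp γ) = ⊤ := by
    refine eq_top_of_index_ne_zero (hK.finiteIndex _ fun g hg => ?_) fun g n hn h y hy => ?_
    · by_cases hg1 : g = 1
      · exact hg1 ▸ Subgroup.one_mem _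
      · exact fun y hy => (hp g hg1).2.1 y
          ⟨hy.1, hy.2.trans (hmin g (Finset.mem_filter.2 ⟨hg, hg1⟩))⟩
    · refine apply_eq_of_pow_apply_eq hn ?_
      have := h y hy
      rwa [map_pow] at this
  have hfix : ∀ g, (γ g).1 (p g₀) = p g₀ := fun g =>
    (eq_top_iff.1 htop (Subgroup.mem_top g) : (γ g).1 ∈ fixingUpTo (p g₀)) _ ⟨hp0, le_rfl⟩
  -- The slope homomorphism at `p g₀` must be trivial, yet `g₀` leaves that point with slope `2 ^
  -- k`, `k ≠ 0`.
  have hχ := hK.eq_one_of_hom (slopeHom γ _ hfix)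
  have := slope_unique hslope (slopeHom_spec γ _ hfix g₀)
  rw [hχ] at this
  exact (hk this).elim

end ForestSkein

/-- If the forest-skein category `FS⟨a, b | x(a) = ρ(b)⟩` is simple, then its `F`-type group embeds
in the bi-orderable group `𝓘F`, is bi-orderable, and has no non-trivial subgroup with
property (T). -/
theorem corollary4p3 (x : BinaryTree Unit) (hx : 2 ≤ x.numLeaves)
    (hsimple : ForestSkein.IsSimpleFS (ForestSkein.vinePresentation x)) :
    ForestSkein.BiOrderable ForestSkein.InfinitePLGroup ∧
    (∃ γ : ForestSkein.FSGroup (ForestSkein.vinePresentation x) →* ForestSkein.InfinitePLGroup,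
      Function.Injective γ) ∧
    ForestSkein.BiOrderable (ForestSkein.FSGroup (ForestSkein.vinePresentation x)) ∧
    ∀ Λ : Subgroup (ForestSkein.FSGroup (ForestSkein.vinePresentation x)),
      ForestSkein.KazhdanPropertyT Λ → Λ = ⊥ := by
  obtain ⟨γ, hγ⟩ := ForestSkein.exists_injective_hom_infinitePLGroup hx hsimple
  refine ⟨ForestSkein.biOrderable_infinitePLGroup, ⟨γ, hγ⟩,
    ForestSkein.biOrderable_infinitePLGroup.of_injective γ hγ,
    fun Λ hΛ => ?_⟩
  have := ForestSkein.subsingleton_of_kazhdanPropertyT hΛ (γ.comp Λ.subtype)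
    (hγ.comp Subtype.val_injective)
  exact Subgroup.eq_bot_of_subsingleton Λ
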